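/- Let $1\le d\le 3$, let $\Omega\subset\mathbb{R}^d$ be a bounded Lipschitz domain with surface measure $\sigma$ on $\partial\Omega$, let $\Gamma_1\subset\partial\Omega$ be Borel measurable, $T>0$, $I=(0,T)$, $\Omega_T=\Omega\times I$, $\Sigma_1=\Gamma_1\times I$, and let $1<p<\frac{d}{d-1}$ (any $1<p<\infty$ if $d=1$), $\frac1p+\frac1{p'}=1$. Let $W^{1,p'}_0(\Omega)$ be the closure of $C_c^\infty(\Omega)$ in $W^{1,p'}(\Omega)$ and $W^{-1,p}(\Omega)$ the dual of $W^{1,p'}_0(\Omega)$. Let $$W:=L^2(I;W^{1,p'}_0(\Omega))\times L^2(\Sigma_1),$$ let $W^*$ be its dual, and let $U$ be the space of all $u\in L^2(I;W^{1,p}(\Omega))$ that have a weak time derivative $\partial_t u\in L^2(I;W^{-1,p}(\Omega))$ and a trace $\operatorname{trace}_{\Sigma_1}u\in L^2(\Sigma_1)$, with the graph norm. Let $\mathcal M(\Omega)$ be the space of finite signed Radon measures on $\Omega$ with the total variation norm and $$X:=\mathcal M(\Omega)\times L^\infty(\Omega_T)\times L^\infty(\Omega_T;\mathbb{R}^d).$$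 Fix $g\in L^2(\Sigma_1)$. Then the formula $$\langle e(u,\mu,k,c),v\rangle:=\int_{\Omega_T}\bigl(-\partial_t u\,v_\Omega+k\nabla u\cdot\nabla v_\Omega+(c\cdot\nabla u)\,v_\Omega\bigr)\,d\xi\,dt-\int_0^T\langle\mu,v_\Omega(t)\rangle\,dt+\int_{\Sigma_1}(\operatorname{trace}_{\Sigma_1}u-g)\,v_{\Gamma_1}\,d\sigma\,dt,$$ for $v=(v_\Omega,v_{\Gamma_1})\in W$, defines an operator $e:U\times X\to W^*$. Here $\int_{\Omega_T}\partial_t u\,v_\Omega\,d\xi\,dt$ stands for $\int_0^T\langle\partial_t u(t),v_\Omega(t)\rangle\,dt$, and $\langle\mu,v_\Omega(t)\rangle$ is the integral over $\Omega$ with respect to $\mu$ of the representative of $v_\Omega(t)$ in $C_0(\Omega)$. At every point $(u,\mu,k,c)\in U\times X$ the operator $e$ is partially Fréchet differentiable with respect to each of $u$, $\mu$, $k$ and $c$. The partial derivatives at $(u,\mu,k,c)$ are bounded linear operators $$e_u\in\mathbb L(U;W^*),\quad e_\mu\in\mathbb L(\mathcal M(\Omega);W^*),\quad e_k\in\mathbb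 L(L^\infty(\Omega_T);W^*),\quad e_c\in\mathbb L(L^\infty(\Omega_T;\mathbb{R}^d);W^*),$$ given, for all $v=(v_\Omega,v_{\Gamma_1})\in W$, $\tilde u\in U$, $\eta\in\mathcal M(\Omega)$, $h\in L^\infty(\Omega_T)$ and $b\in L^\infty(\Omega_T;\mathbb{R}^d)$, by $$\langle e_u\tilde u,v\rangle=\int_{\Omega_T}\bigl(-\partial_t\tilde u\,v_\Omega+k\nabla\tilde u\cdot\nabla v_\Omega+(c\cdot\nabla\tilde u)\,v_\Omega\bigr)\,d\xi\,dt+\int_{\Sigma_1}(\operatorname{trace}_{\Sigma_1}\tilde u)\,v_{\Gamma_1}\,d\sigma\,dt,$$ $$\langle e_\mu\eta,v\rangle=-\int_0^T\langle\eta,v_\Omega(t)\rangle\,dt,\qquad \langle e_k h,v\rangle=\int_{\Omega_T}h\,\nabla u\cdot\nabla v_\Omega\,d\xi\,dt,\qquad \langle e_c b,v\rangle=\int_{\Omega_T}(b\cdot\nabla u)\,v_\Omega\,d\xi\,dt.$$ -/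

import Mathlib

open MeasureTheory Set Filter Topology
open scoped ENNReal NNReal ContDiff ZeroAtInfty Gradient InnerProductSpace

noncomputable section

namespace ConvDiff

/-- Physical space `ℝ^d` with its Euclidean norm. -/
abbrev Sp (d : ℕ) : Type := EuclideanSpace ℝ (Fin d)

/-- `Ω` is a bounded Lipschitz domain: bounded, open, connected, and near each boundary point it is,
for some unit direction `ν`, the region strictly above the graph of a Lipschitz function of the
component orthogonal to `ν`. -/
structure IsBoundedLipschitzDomain {d : ℕ} (Ω : Set (Sp d)) : Prop where
  isOpen : IsOpen Ω
  isConnected : IsConnected Ω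
  isBounded : Bornology.IsBounded Ω
  lipschitz_boundary : ∀ x ∈ frontier Ω, ∃ N ∈ 𝓝 x, ∃ ν : Sp d, ‖ν‖ = 1 ∧
    ∃ (K : ℝ≥0) (γ : Sp d → ℝ), LipschitzWith K γ ∧
      ∀ y ∈ N, (y ∈ Ω ↔ γ (y - ⟪ν, y⟫_ℝ • ν) < ⟪ν, y⟫_ℝ)

/-- The time interval `I = (0, T)` with Lebesgue measure. -/
abbrev timeMeasure (T : ℝ) : Measure ℝ := volume.restrict (Ioo 0 T)

/-- Surface measure on `Γ₁`: the normalised `(d-1)`-dimensional Hausdorff measure. -/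
abbrev surfaceMeasure {d : ℕ} (Γ₁ : Set (Sp d)) : Measure (Sp d) :=
  (μHE[d - 1] : Measure (Sp d)).restrict Γ₁

/-! ### Sobolev spaces -/

/-- Test functions: smooth with compact support contained in `Ω`. -/
def IsTest {V : Type*} [NormedAddCommGroup V] [NormedSpace ℝ V] (Ω : Set V) (φ : V → ℝ) : Prop :=
  ContDiff ℝ ∞ φ ∧ HasCompactSupport φ ∧ tsupport φ ⊆ Ω

/-- `F` is the weak (distributional) gradient of `f` on `Ω`. -/
def IsWeakGradient {d : ℕ} (Ω : Set (Sp d)) (f : Sp d → ℝ) (F : Sp d → Sp d) : Prop :=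
  ∀ φ : Sp d → ℝ, IsTest Ω φ →
    ∫ ξ in Ω, f ξ • ∇ φ ξ = -∫ ξ in Ω, φ ξ • F ξ

lemma continuous_gradient {d : ℕ} {φ : Sp d → ℝ} (hφ : ContDiff ℝ ∞ φ) : Continuous (∇ φ) := by
  have h := hφ.continuous_fderiv (by simp)
  exact (InnerProductSpace.toDual ℝ (Sp d)).symm.continuous.comp h

lemma hasCompactSupport_gradient {d : ℕ} {φ : Sp d → ℝ} (hφ : HasCompactSupport φ) :
    HasCompactSupport (∇ φ) :=
  (hφ.fderiv ℝ).comp_left (g := (InnerProductSpace.toDual ℝ (Sp d)).symm) (map_zero _)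

section Sobolev

variable {d : ℕ} (p : ℝ≥0∞) [hp1 : Fact (1 ≤ p)] (Ω : Set (Sp d))

lemma integrable_smul_gradient (f : Lp ℝ p (volume.restrict Ω)) {φ : Sp d → ℝ}
    (hφ : IsTest Ω φ) : Integrable (fun ξ => f ξ • ∇ φ ξ) (volume.restrict Ω) := by
  have hf := ((Lp.memLp f).locallyIntegrable hp1.out)
  exact hf.integrable_smul_right_of_hasCompactSupport (continuous_gradient hφ.1)
    (hasCompactSupport_gradient hφ.2.1)

lemma integrable_test_smul (F : Lp (Sp d) p (volume.restrict Ω)) {φ : Sp d → ℝ}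
    (hφ : IsTest Ω φ) : Integrable (fun ξ => φ ξ • F ξ) (volume.restrict Ω) := by
  have hf := ((Lp.memLp F).locallyIntegrable hp1.out)
  exact hf.integrable_smul_left_of_hasCompactSupport hφ.1.continuous hφ.2.1

/-- The pairs `(f, F) ∈ L^p(Ω) × L^p(Ω; ℝ^d)` in which `F` is the weak gradient of `f`. -/
def sobolevSubmodule : Submodule ℝ
    (WithLp p (Lp ℝ p (volume.restrict Ω) × Lp (Sp d) p (volume.restrict Ω))) where
  carrier := {w | IsWeakGradient Ω w.fst w.snd}
  zero_mem' := by
    intro φ hφ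
    have h1 : ∀ᵐ ξ ∂(volume.restrict Ω), (0 : Lp ℝ p (volume.restrict Ω)) ξ • ∇ φ ξ = 0 := by
      filter_upwards [Lp.coeFn_zero ℝ p (volume.restrict Ω)] with ξ h
      rw [h, Pi.zero_apply, zero_smul]
    have h2 : ∀ᵐ ξ ∂(volume.restrict Ω), φ ξ • (0 : Lp (Sp d) p (volume.restrict Ω)) ξ = 0 := by
      filter_upwards [Lp.coeFn_zero (Sp d) p (volume.restrict Ω)] with ξ h
      rw [h, Pi.zero_apply, smul_zero]
    simp only [WithLp.zero_fst, WithLp.zero_snd]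
    rw [integral_congr_ae h1, integral_congr_ae h2]
    simp
  add_mem' := by
    intro a b ha hb φ hφ
    have h1 : ∀ᵐ ξ ∂(volume.restrict Ω), (a.fst + b.fst : Lp ℝ p (volume.restrict Ω)) ξ • ∇ φ ξ
        = a.fst ξ • ∇ φ ξ + b.fst ξ • ∇ φ ξ := by
      filter_upwards [Lp.coeFn_add a.fst b.fst] with ξ h
      rw [h, Pi.add_apply, add_smul]
    have h2 : ∀ᵐ ξ ∂(volume.restrict Ω), φ ξ • (a.snd + b.snd : Lp (Sp d) p (volume.restrict Ω)) ξ
        = φ ξ • a.snd ξ + φ ξ • b.snd ξ := by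
      filter_upwards [Lp.coeFn_add a.snd b.snd] with ξ h
      rw [h, Pi.add_apply, smul_add]
    simp only [WithLp.add_fst, WithLp.add_snd]
    rw [integral_congr_ae h1, integral_congr_ae h2,
      integral_add (integrable_smul_gradient p Ω _ hφ) (integrable_smul_gradient p Ω _ hφ),
      integral_add (integrable_test_smul p Ω _ hφ) (integrable_test_smul p Ω _ hφ),
      ha φ hφ, hb φ hφ, neg_add]
  smul_mem' := by
    intro r a ha φ hφ
    have h1 : ∀ᵐ ξ ∂(volume.restrict Ω), (r • a.fst : Lp ℝ p (volume.restrict Ω)) ξ • ∇ φ ξ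
        = r • (a.fst ξ • ∇ φ ξ) := by
      filter_upwards [Lp.coeFn_smul r a.fst] with ξ h
      rw [h, Pi.smul_apply, smul_assoc]
    have h2 : ∀ᵐ ξ ∂(volume.restrict Ω), φ ξ • (r • a.snd : Lp (Sp d) p (volume.restrict Ω)) ξ
        = r • (φ ξ • a.snd ξ) := by
      filter_upwards [Lp.coeFn_smul r a.snd] with ξ h
      rw [h, Pi.smul_apply, smul_comm]
    simp only [WithLp.smul_fst, WithLp.smul_snd]
    rw [integral_congr_ae h1, integral_congr_ae h2, integral_smul, integral_smul, ha φ hφ, smul_neg]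

/-- The Sobolev space `W^{1,p}(Ω)`, with the norm `(‖f‖_p ^ p + ‖∇f‖_p ^ p) ^ (1/p)`. An element
is a function in `L^p(Ω)` together with its weak gradient. -/
def W1 : Type := sobolevSubmodule p Ω

instance : NormedAddCommGroup (W1 p Ω) :=
  inferInstanceAs (NormedAddCommGroup (sobolevSubmodule p Ω))

instance : NormedSpace ℝ (W1 p Ω) := inferInstanceAs (NormedSpace ℝ (sobolevSubmodule p Ω))

/-- The map from an element of `W^{1,p}(Ω)` to the underlying function. -/
def W1.fnL : W1 p Ω →L[ℝ] Lp ℝ p (volume.restrict Ω) :=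
  (WithLp.fstL p ℝ _ _).comp (sobolevSubmodule p Ω).subtypeL

/-- The map from an element of `W^{1,p}(Ω)` to its weak gradient. -/
def W1.gradL : W1 p Ω →L[ℝ] Lp (Sp d) p (volume.restrict Ω) :=
  (WithLp.sndL p ℝ _ _).comp (sobolevSubmodule p Ω).subtypeL

variable {p Ω}

/-- The underlying function of an element of `W^{1,p}(Ω)`. -/
def W1.fn (w : W1 p Ω) : Lp ℝ p (volume.restrict Ω) := W1.fnL p Ω w

/-- The weak gradient of an element of `W^{1,p}(Ω)`. -/
def W1.grad (w : W1 p Ω) : Lp (Sp d) p (volume.restrict Ω) := W1.gradL p Ω w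

variable (p Ω)

/-- The closure in `W^{1,p}(Ω)` of the test functions on `Ω`. -/
def sobolevZeroSubmodule : Submodule ℝ (W1 p Ω) :=
  (Submodule.span ℝ {w : W1 p Ω | ∃ φ : Sp d → ℝ, IsTest Ω φ ∧
    w.fn =ᵐ[volume.restrict Ω] φ}).topologicalClosure

/-- The space `W₀^{1,p}(Ω)`, with the norm of `W^{1,p}(Ω)`. -/
def W10 : Type := sobolevZeroSubmodule p Ω

instance : NormedAddCommGroup (W10 p Ω) :=
  inferInstanceAs (NormedAddCommGroup (sobolevZeroSubmodule p Ω))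

instance : NormedSpace ℝ (W10 p Ω) := inferInstanceAs (NormedSpace ℝ (sobolevZeroSubmodule p Ω))

/-- The inclusion of `W₀^{1,p}(Ω)` in `W^{1,p}(Ω)`. -/
def W10.inclL : W10 p Ω →L[ℝ] W1 p Ω := (sobolevZeroSubmodule p Ω).subtypeL

variable {p Ω}

/-- The underlying function of an element of `W₀^{1,p}(Ω)`. -/
def W10.fn (w : W10 p Ω) : Lp ℝ p (volume.restrict Ω) := (W10.inclL p Ω w).fn

/-- The weak gradient of an element of `W₀^{1,p}(Ω)`. -/
def W10.grad (w : W10 p Ω) : Lp (Sp d) p (volume.restrict Ω) := (W10.inclL p Ω w).grad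

end Sobolev

/-- The embedding of `W^{1,p}(Ω)` into the dual `W^{-1,p}(Ω)` of `W₀^{1,q}(Ω)`, `1/p + 1/q = 1`:
`u ↦ (ψ ↦ ∫_Ω u ψ)`. -/
def toNegSobolev {d : ℕ} (p q : ℝ≥0∞) [Fact (1 ≤ p)] [Fact (1 ≤ q)] [p.HolderConjugate q]
    (Ω : Set (Sp d)) : W1 p Ω →L[ℝ] StrongDual ℝ (W10 q Ω) :=
  ((ContinuousLinearMap.lsmul ℝ ℝ).lpPairing (volume.restrict Ω) p q).bilinearComp
    (W1.fnL p Ω) ((W1.fnL q Ω).comp (W10.inclL q Ω))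

lemma toNegSobolev_apply {d : ℕ} (p q : ℝ≥0∞) [Fact (1 ≤ p)] [Fact (1 ≤ q)] [p.HolderConjugate q]
    (Ω : Set (Sp d)) (u : W1 p Ω) (ψ : W10 q Ω) :
    toNegSobolev p q Ω u ψ = ∫ ξ in Ω, u.fn ξ * ψ.fn ξ :=
  ContinuousLinearMap.lpPairing_eq_integral (ContinuousLinearMap.lsmul ℝ ℝ) u.fn ψ.fn

/-! ### Traces -/

/-- `τ ∈ L²(Γ₁)` is the trace of `w ∈ W^{1,p}(Ω)` on `Γ₁`: there are smooth functions on `ℝ^d` whose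
restrictions to `Ω` converge to `w` in `W^{1,p}(Ω)` and whose restrictions to `Γ₁` converge to `τ`
in `L^p(Γ₁)`. -/
def IsTrace {d : ℕ} {p : ℝ≥0∞} [Fact (1 ≤ p)] {Ω Γ₁ : Set (Sp d)} (w : W1 p Ω)
    (τ : Lp ℝ 2 (surfaceMeasure Γ₁)) : Prop :=
  ∃ φ : ℕ → Sp d → ℝ, (∀ n, ContDiff ℝ ∞ (φ n) ∧ HasCompactSupport (φ n)) ∧
    Tendsto (fun n => eLpNorm (fun ξ => φ n ξ - w.fn ξ) p (volume.restrict Ω)) atTop (𝓝 0) ∧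
    Tendsto (fun n => eLpNorm (fun ξ => ∇ (φ n) ξ - w.grad ξ) p (volume.restrict Ω)) atTop (𝓝 0) ∧
    Tendsto (fun n => eLpNorm (fun ξ => φ n ξ - τ ξ) p (surfaceMeasure Γ₁)) atTop (𝓝 0)

section TraceLemmas

variable {α V : Type*} [MeasurableSpace α] {μ : Measure α} [NormedAddCommGroup V]
  {p : ℝ≥0∞}

lemma tendsto_eLpNorm_sub_add (hp : 1 ≤ p) {a b : ℕ → α → V} {f g h : α → V}
    (ha : ∀ n, AEStronglyMeasurable (a n - f) μ) (hb : ∀ n, AEStronglyMeasurable (b n - g) μ)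
    (h1 : Tendsto (fun n => eLpNorm (a n - f) p μ) atTop (𝓝 0))
    (h2 : Tendsto (fun n => eLpNorm (b n - g) p μ) atTop (𝓝 0)) (hh : h =ᵐ[μ] f + g) :
    Tendsto (fun n => eLpNorm (a n + b n - h) p μ) atTop (𝓝 0) := by
  have h3 := h1.add h2
  rw [add_zero] at h3
  refine tendsto_of_tendsto_of_tendsto_of_le_of_le tendsto_const_nhds h3 (fun _ => zero_le) ?_
  intro n
  have : a n + b n - h =ᵐ[μ] (a n - f) + (b n - g) := by
    filter_upwards [hh] with x hx
    simp [hx]; abel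
  simp only
  rw [eLpNorm_congr_ae this]
  exact eLpNorm_add_le (ha n) (hb n) hp

lemma tendsto_eLpNorm_sub_smul [NormedSpace ℝ V] (r : ℝ) {a : ℕ → α → V} {f h : α → V}
    (h1 : Tendsto (fun n => eLpNorm (a n - f) p μ) atTop (𝓝 0)) (hh : h =ᵐ[μ] r • f) :
    Tendsto (fun n => eLpNorm (r • a n - h) p μ) atTop (𝓝 0) := by
  have h3 := ENNReal.Tendsto.const_mul (a := ‖r‖ₑ) h1 (Or.inr (by simp))
  rw [mul_zero] at h3
  refine h3.congr fun n => ?_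
  have : r • a n - h =ᵐ[μ] r • (a n - f) := by
    filter_upwards [hh] with x hx
    simp [hx, smul_sub]
  rw [eLpNorm_congr_ae this, eLpNorm_const_smul]

end TraceLemmas

section TraceLinear

variable {d : ℕ} {p : ℝ≥0∞} [hp1 : Fact (1 ≤ p)] {Ω Γ₁ : Set (Sp d)}

lemma gradient_add' {f g : Sp d → ℝ} (hf : ContDiff ℝ ∞ f) (hg : ContDiff ℝ ∞ g) :
    ∇ (f + g) = ∇ f + ∇ g := by
  ext1 x
  have h1 := (hf.differentiable (by simp)) x
  have h2 := (hg.differentiable (by simp)) x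
  simp [gradient, fderiv_add h1 h2]

lemma gradient_smul' (r : ℝ) {f : Sp d → ℝ} (hf : ContDiff ℝ ∞ f) :
    ∇ (r • f) = r • ∇ f := by
  ext1 x
  have h1 := (hf.differentiable (by simp)) x
  simp [gradient, fderiv_const_smul h1 r]

lemma IsTrace.zero : IsTrace (0 : W1 p Ω) (0 : Lp ℝ 2 (surfaceMeasure Γ₁)) := by
  have key : ∀ {α V : Type} [MeasurableSpace α] [NormedAddCommGroup V] {μ : Measure α}
      {a f : α → V}, a = 0 → f =ᵐ[μ] 0 →
      Tendsto (fun _ : ℕ => eLpNorm (fun ξ => a ξ - f ξ) p μ) atTop (𝓝 0) := by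
    intro α V _ _ μ a f ha hf
    have : (fun ξ => a ξ - f ξ) =ᵐ[μ] 0 := by
      filter_upwards [hf] with ξ h
      simp [h, ha]
    simp [eLpNorm_congr_ae this]
  refine ⟨fun _ => 0, fun _ => ⟨contDiff_const, HasCompactSupport.zero⟩, key rfl ?_, key ?_ ?_,
    key rfl (Lp.coeFn_zero _ _ _)⟩
  · have : (0 : W1 p Ω).fn = 0 := map_zero (W1.fnL p Ω)
    rw [this]
    exact Lp.coeFn_zero _ _ _
  · ext1 x
    simp [gradient]
  · have : (0 : W1 p Ω).grad = 0 := map_zero (W1.gradL p Ω)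
    rw [this]
    exact Lp.coeFn_zero _ _ _

lemma IsTrace.add {w w' : W1 p Ω} {τ τ' : Lp ℝ 2 (surfaceMeasure Γ₁)} (h : IsTrace w τ)
    (h' : IsTrace w' τ') : IsTrace (w + w') (τ + τ') := by
  obtain ⟨φ, h0, h1, h2, h3⟩ := h
  obtain ⟨φ', h0', h1', h2', h3'⟩ := h'
  refine ⟨fun n => φ n + φ' n, fun n => ⟨(h0 n).1.add (h0' n).1, (h0 n).2.add (h0' n).2⟩, ?_, ?_, ?_⟩
  · exact tendsto_eLpNorm_sub_add hp1.out
      (fun n => (h0 n).1.continuous.aestronglyMeasurable.sub (Lp.aestronglyMeasurable _))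
      (fun n => (h0' n).1.continuous.aestronglyMeasurable.sub (Lp.aestronglyMeasurable _))
      h1 h1' (Lp.coeFn_add _ _)
  · simp_rw [fun n => gradient_add' (h0 n).1 (h0' n).1]
    exact tendsto_eLpNorm_sub_add hp1.out
      (fun n => (continuous_gradient (h0 n).1).aestronglyMeasurable.sub (Lp.aestronglyMeasurable _))
      (fun n => (continuous_gradient (h0' n).1).aestronglyMeasurable.sub (Lp.aestronglyMeasurable _))
      h2 h2' (Lp.coeFn_add _ _)
  · exact tendsto_eLpNorm_sub_add hp1.out
      (fun n => (h0 n).1.continuous.aestronglyMeasurable.sub (Lp.aestronglyMeasurable _))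
      (fun n => (h0' n).1.continuous.aestronglyMeasurable.sub (Lp.aestronglyMeasurable _))
      h3 h3' (Lp.coeFn_add _ _)

lemma IsTrace.smul (r : ℝ) {w : W1 p Ω} {τ : Lp ℝ 2 (surfaceMeasure Γ₁)} (h : IsTrace w τ) :
    IsTrace (r • w) (r • τ) := by
  obtain ⟨φ, h0, h1, h2, h3⟩ := h
  refine ⟨fun n => r • φ n, fun n => ⟨contDiff_const.smul (h0 n).1,
    (h0 n).2.comp_left (g := fun y => r • y) (smul_zero r)⟩, ?_, ?_, ?_⟩
  · exact tendsto_eLpNorm_sub_smul r h1 (Lp.coeFn_smul _ _)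
  · simp_rw [fun n => gradient_smul' r (h0 n).1]
    exact tendsto_eLpNorm_sub_smul r h2 (Lp.coeFn_smul _ _)
  · exact tendsto_eLpNorm_sub_smul r h3 (Lp.coeFn_smul _ _)

end TraceLinear

/-! ### The state space -/

section StateSpace

variable {d : ℕ} (p q : ℝ≥0∞) [Fact (1 ≤ p)] [Fact (1 ≤ q)] [p.HolderConjugate q]
  (Ω Γ₁ : Set (Sp d)) (T : ℝ)

/-- `u'` is the weak time derivative of `u`: both are regarded as functions of time with values in
`W^{-1,p}(Ω)`, the dual of `W₀^{1,q}(Ω)`. -/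
def IsTimeDeriv {p q : ℝ≥0∞} [Fact (1 ≤ p)] [Fact (1 ≤ q)] [p.HolderConjugate q]
    {Ω : Set (Sp d)} {T : ℝ} (u : Lp (W1 p Ω) 2 (timeMeasure T))
    (u' : Lp (StrongDual ℝ (W10 q Ω)) 2 (timeMeasure T)) : Prop :=
  ∀ φ : ℝ → ℝ, IsTest (Ioo 0 T) φ →
    ∫ t in Ioo 0 T, deriv φ t • toNegSobolev p q Ω (u t) = -∫ t in Ioo 0 T, φ t • u' t

/-- The boundary space `L²(Σ₁) = L²(0, T; L²(Γ₁))`, `Σ₁ = Γ₁ × (0, T)`. -/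
abbrev BoundarySpace : Type := Lp (Lp ℝ 2 (surfaceMeasure Γ₁)) 2 (timeMeasure T)

lemma integrable_deriv_smul (u : Lp (W1 p Ω) 2 (timeMeasure T)) {φ : ℝ → ℝ}
    (hφ : IsTest (Ioo 0 T) φ) :
    Integrable (fun t => deriv φ t • toNegSobolev p q Ω (u t)) (timeMeasure T) := by
  have h := ((toNegSobolev p q Ω).comp_memLp u).locallyIntegrable (by norm_num)
  exact h.integrable_smul_left_of_hasCompactSupport (hφ.1.continuous_deriv (by simp)) hφ.2.1.deriv

lemma integrable_test_smul_time {V : Type*} [NormedAddCommGroup V] [NormedSpace ℝ V]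
    (f : Lp V 2 (timeMeasure T)) {φ : ℝ → ℝ} (hφ : IsTest (Ioo 0 T) φ) :
    Integrable (fun t => φ t • f t) (timeMeasure T) :=
  ((Lp.memLp f).locallyIntegrable (by norm_num)).integrable_smul_left_of_hasCompactSupport
    hφ.1.continuous hφ.2.1

/-- Triples of a function `u ∈ L²(0, T; W^{1,p}(Ω))`, its weak time derivative in
`L²(0, T; W^{-1,p}(Ω))` and its trace in `L²(Σ₁)`. -/
def stateSubmodule : Submodule ℝ (Lp (W1 p Ω) 2 (timeMeasure T) ×
    Lp (StrongDual ℝ (W10 q Ω)) 2 (timeMeasure T) × BoundarySpace Γ₁ T) where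
  carrier := {x | IsTimeDeriv x.1 x.2.1 ∧ ∀ᵐ t ∂(timeMeasure T), IsTrace (x.1 t) (x.2.2 t)}
  zero_mem' := by
    refine ⟨fun φ hφ => ?_, ?_⟩
    · have h1 : ∀ᵐ t ∂(timeMeasure T),
          deriv φ t • toNegSobolev p q Ω ((0 : Lp (W1 p Ω) 2 (timeMeasure T)) t) = 0 := by
        filter_upwards [Lp.coeFn_zero (W1 p Ω) 2 (timeMeasure T)] with t h
        rw [h, Pi.zero_apply, map_zero, smul_zero]
      have h2 : ∀ᵐ t ∂(timeMeasure T),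
          φ t • (0 : Lp (StrongDual ℝ (W10 q Ω)) 2 (timeMeasure T)) t = 0 := by
        filter_upwards [Lp.coeFn_zero (StrongDual ℝ (W10 q Ω)) 2 (timeMeasure T)] with t h
        rw [h, Pi.zero_apply, smul_zero]
      simp only [Prod.fst_zero, Prod.snd_zero]
      rw [integral_congr_ae h1, integral_congr_ae h2]
      simp
    · filter_upwards [Lp.coeFn_zero (W1 p Ω) 2 (timeMeasure T),
        Lp.coeFn_zero (Lp ℝ 2 (surfaceMeasure Γ₁)) 2 (timeMeasure T)] with t h h'
      simp only [Prod.fst_zero, Prod.snd_zero, h, h', Pi.zero_apply]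
      exact IsTrace.zero
  add_mem' := by
    rintro a b ⟨ha, ha'⟩ ⟨hb, hb'⟩
    refine ⟨fun φ hφ => ?_, ?_⟩
    · have h1 : ∀ᵐ t ∂(timeMeasure T), deriv φ t • toNegSobolev p q Ω ((a.1 + b.1) t)
          = deriv φ t • toNegSobolev p q Ω (a.1 t) + deriv φ t • toNegSobolev p q Ω (b.1 t) := by
        filter_upwards [Lp.coeFn_add a.1 b.1] with t h
        rw [h, Pi.add_apply, map_add, smul_add]
      have h2 : ∀ᵐ t ∂(timeMeasure T), φ t • (a.2.1 + b.2.1) t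
          = φ t • a.2.1 t + φ t • b.2.1 t := by
        filter_upwards [Lp.coeFn_add a.2.1 b.2.1] with t h
        rw [h, Pi.add_apply, smul_add]
      simp only [Prod.fst_add, Prod.snd_add]
      rw [integral_congr_ae h1, integral_congr_ae h2,
        integral_add (integrable_deriv_smul p q Ω T _ hφ) (integrable_deriv_smul p q Ω T _ hφ),
        integral_add (integrable_test_smul_time T _ hφ) (integrable_test_smul_time T _ hφ),
        ha φ hφ, hb φ hφ, neg_add]
    · filter_upwards [ha', hb', Lp.coeFn_add a.1 b.1, Lp.coeFn_add a.2.2 b.2.2] with t h h' h1 h2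
      simp only [Prod.fst_add, Prod.snd_add, h1, h2, Pi.add_apply]
      exact h.add h'
  smul_mem' := by
    rintro r a ⟨ha, ha'⟩
    refine ⟨fun φ hφ => ?_, ?_⟩
    · have h1 : ∀ᵐ t ∂(timeMeasure T), deriv φ t • toNegSobolev p q Ω ((r • a.1) t)
          = r • (deriv φ t • toNegSobolev p q Ω (a.1 t)) := by
        filter_upwards [Lp.coeFn_smul r a.1] with t h
        rw [h, Pi.smul_apply, map_smul, smul_comm]
      have h2 : ∀ᵐ t ∂(timeMeasure T), φ t • (r • a.2.1) t = r • (φ t • a.2.1 t) := by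
        filter_upwards [Lp.coeFn_smul r a.2.1] with t h
        rw [h, Pi.smul_apply, smul_comm]
      simp only [Prod.smul_fst, Prod.smul_snd]
      rw [integral_congr_ae h1, integral_congr_ae h2, integral_smul, integral_smul, ha φ hφ,
        smul_neg]
    · filter_upwards [ha', Lp.coeFn_smul r a.1, Lp.coeFn_smul r a.2.2] with t h h1 h2
      simp only [Prod.smul_fst, Prod.smul_snd, h1, h2, Pi.smul_apply]
      exact h.smul r

/-- The state space `U`: functions `u ∈ L²(0, T; W^{1,p}(Ω))` which have a weak time derivative in
`L²(0, T; W^{-1,p}(Ω))` and a trace in `L²(Σ₁)`, with (a norm equivalent to) the graph norm. -/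
def StateSpace : Type := stateSubmodule p q Ω Γ₁ T

instance : NormedAddCommGroup (StateSpace p q Ω Γ₁ T) :=
  inferInstanceAs (NormedAddCommGroup (stateSubmodule p q Ω Γ₁ T))

instance : NormedSpace ℝ (StateSpace p q Ω Γ₁ T) :=
  inferInstanceAs (NormedSpace ℝ (stateSubmodule p q Ω Γ₁ T))

variable {p q Ω Γ₁ T}

/-- The function `u ∈ L²(0, T; W^{1,p}(Ω))` underlying a state. -/
def StateSpace.fn (u : StateSpace p q Ω Γ₁ T) : Lp (W1 p Ω) 2 (timeMeasure T) := u.1.1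

/-- The time derivative `∂ₜ u ∈ L²(0, T; W^{-1,p}(Ω))` of a state. -/
def StateSpace.dt (u : StateSpace p q Ω Γ₁ T) :
    Lp (StrongDual ℝ (W10 q Ω)) 2 (timeMeasure T) := u.1.2.1

/-- The trace on `Σ₁` of a state. -/
def StateSpace.trace (u : StateSpace p q Ω Γ₁ T) : BoundarySpace Γ₁ T := u.1.2.2

variable (q Ω Γ₁ T)

/-- The test space `W = L²(0, T; W₀^{1,q}(Ω)) × L²(Σ₁)`. -/
abbrev TestSpace : Type := Lp (W10 q Ω) 2 (timeMeasure T) × BoundarySpace Γ₁ T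

end StateSpace

/-! ### The parameter space -/

/-- The space `M(Ω)` of finite signed Borel (Radon) measures on `Ω`, normed by total variation. -/
def RadonMeasure {d : ℕ} (Ω : Set (Sp d)) : Type := SignedMeasure Ω

namespace RadonMeasure

variable {d : ℕ} {Ω : Set (Sp d)}

instance : AddCommGroup (RadonMeasure Ω) := inferInstanceAs (AddCommGroup (SignedMeasure Ω))

instance : Module ℝ (RadonMeasure Ω) := inferInstanceAs (Module ℝ (SignedMeasure Ω))

/-- The signed measure underlying an element of `M(Ω)`. -/
def toSigned (μ : RadonMeasure Ω) : SignedMeasure Ω := μ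

instance : Norm (RadonMeasure Ω) := ⟨fun μ => μ.toSigned.totalVariation.real univ⟩

lemma norm_def (μ : RadonMeasure Ω) : ‖μ‖ = μ.toSigned.totalVariation.real univ := rfl

lemma normedSpaceCore : NormedSpace.Core ℝ (RadonMeasure Ω) where
  norm_nonneg μ := measureReal_nonneg
  norm_smul r μ := by
    rw [norm_def, norm_def]
    have : (r • μ).toSigned = r • μ.toSigned := rfl
    rw [this, SignedMeasure.totalVariation_eq_variation, SignedMeasure.totalVariation_eq_variation,
      VectorMeasure.variation_smul]
    simp [measureReal_def]
  norm_triangle μ ν := by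
    rw [norm_def, norm_def, norm_def]
    have : (μ + ν).toSigned = μ.toSigned + ν.toSigned := rfl
    have h : (μ.toSigned + ν.toSigned).totalVariation univ ≤
        μ.toSigned.totalVariation univ + ν.toSigned.totalVariation univ := by
      simp only [SignedMeasure.totalVariation_eq_variation]
      exact VectorMeasure.variation_add_le univ
    rw [this, measureReal_def, measureReal_def, measureReal_def,
      ← ENNReal.toReal_add (measure_ne_top _ _) (measure_ne_top _ _)]
    exact ENNReal.toReal_mono (by finiteness) h
  norm_eq_zero_iff μ := by
    rw [norm_def, measureReal_eq_zero_iff, Measure.measure_univ_eq_zero,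
      SignedMeasure.totalVariation_eq_variation, VectorMeasure.variation_eq_zero]
    rfl

instance : NormedAddCommGroup (RadonMeasure Ω) := NormedAddCommGroup.ofCore normedSpaceCore

instance : NormedSpace ℝ (RadonMeasure Ω) := NormedSpace.ofCore normedSpaceCore

/-- The duality `⟨μ, f⟩ = ∫_Ω f dμ` between `M(Ω)` and `C₀(Ω)`. -/
def pair (μ : RadonMeasure Ω) (f : C₀(Ω, ℝ)) : ℝ :=
  (∫ ξ, f ξ ∂μ.toSigned.toJordanDecomposition.posPart) -
    ∫ ξ, f ξ ∂μ.toSigned.toJordanDecomposition.negPart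

end RadonMeasure

/-- The space-time cylinder `Ω_T = Ω × (0, T)` with Lebesgue measure. -/
abbrev cylinderMeasure {d : ℕ} (Ω : Set (Sp d)) (T : ℝ) : Measure (Sp d × ℝ) :=
  volume.restrict (Ω ×ˢ Ioo 0 T)

/-- `L^∞(Ω_T; V)`. -/
abbrev LInfty {d : ℕ} (Ω : Set (Sp d)) (T : ℝ) (V : Type) [NormedAddCommGroup V] : Type :=
  Lp V ∞ (cylinderMeasure Ω T)

/-- The parameter space `X = M(Ω) × L^∞(Ω_T) × L^∞(Ω_T; ℝ^d)`. -/
abbrev ParamSpace {d : ℕ} (Ω : Set (Sp d)) (T : ℝ) : Type :=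
  RadonMeasure Ω × LInfty Ω T ℝ × LInfty Ω T (Sp d)

/-! ### The terms of the weak form

Elements of `L²(0, T; W^{1,p}(Ω))` are functions of time with values in classes of functions on `Ω`,
so integrals over `Ω_T` are written as iterated integrals, first over `Ω`, then over `(0, T)`. -/

section WeakForm

variable {d : ℕ} {p q : ℝ≥0∞} [Fact (1 ≤ p)] [Fact (1 ≤ q)] {Ω Γ₁ : Set (Sp d)} {T : ℝ}

open Classical in
/-- The representative in `C₀(Ω)` of an element of `W₀^{1,q}(Ω)` (it exists if `q > d`, by the
Sobolev embedding, and is then unique). -/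
def c0Rep (w : W10 q Ω) : C₀(Ω, ℝ) :=
  if h : ∃ f : C₀(Ω, ℝ), ∀ᵐ ξ ∂(volume.restrict Ω), ∀ hξ : ξ ∈ Ω, f ⟨ξ, hξ⟩ = w.fn ξ
  then h.choose else 0

/-- `∫_{Ω_T} u' v dξ dt`, for `u' ∈ L²(0, T; W^{-1,p}(Ω))`, as `∫_0^T ⟨u'(t), v(t)⟩ dt`. -/
def timeTerm (u' : Lp (StrongDual ℝ (W10 q Ω)) 2 (timeMeasure T))
    (v : Lp (W10 q Ω) 2 (timeMeasure T)) : ℝ :=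
  ∫ t in Ioo 0 T, u' t (v t)

/-- `∫_{Ω_T} k ∇u · ∇v dξ dt`. -/
def diffusionTerm (k : LInfty Ω T ℝ) (u : Lp (W1 p Ω) 2 (timeMeasure T))
    (v : Lp (W10 q Ω) 2 (timeMeasure T)) : ℝ :=
  ∫ t in Ioo 0 T, ∫ ξ in Ω, k (ξ, t) * ⟪(u t).grad ξ, (v t).grad ξ⟫_ℝ

/-- `∫_{Ω_T} (c · ∇u) v dξ dt`. -/
def convectionTerm (c : LInfty Ω T (Sp d)) (u : Lp (W1 p Ω) 2 (timeMeasure T))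
    (v : Lp (W10 q Ω) 2 (timeMeasure T)) : ℝ :=
  ∫ t in Ioo 0 T, ∫ ξ in Ω, ⟪c (ξ, t), (u t).grad ξ⟫_ℝ * (v t).fn ξ

/-- `∫_0^T ⟨μ, v(t)⟩ dt`. -/
def sourceTerm (μ : RadonMeasure Ω) (v : Lp (W10 q Ω) 2 (timeMeasure T)) : ℝ :=
  ∫ t in Ioo 0 T, μ.pair (c0Rep (v t))

/-- `∫_{Σ₁} τ v dσ dt`. -/
def boundaryTerm (τ v : BoundarySpace Γ₁ T) : ℝ :=
  ∫ t in Ioo 0 T, ∫ ξ, τ t ξ * v t ξ ∂(surfaceMeasure Γ₁)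

/-- The value `⟨e(u, μ, k, c), v⟩` of the weak form with boundary data `g`. -/
def weakForm [p.HolderConjugate q] (g : BoundarySpace Γ₁ T) (u : StateSpace p q Ω Γ₁ T)
    (μ : RadonMeasure Ω) (k : LInfty Ω T ℝ) (c : LInfty Ω T (Sp d))
    (v : TestSpace q Ω Γ₁ T) : ℝ :=
  -timeTerm u.dt v.1 + diffusionTerm k u.fn v.1 + convectionTerm c u.fn v.1
    - sourceTerm μ v.1 + boundaryTerm (u.trace - g) v.2

end WeakForm

end ConvDiff

end

/-! The weak form is affine in each of `u`, `μ`, `k` and `c` when the other three are held fixed: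
every term is a bounded bilinear expression in `v` and one of the data, once the remaining datum is
frozen. An affine map with bounded linear part is differentiable everywhere, and its derivative is
that linear part (`hasFDerivAt_of_sub_eq`). The substance is therefore the boundedness of each term,
including the measurability and integrability that make it bilinear at all.

The time and boundary terms are Hölder pairings in time of Banach-space pairings. The diffusion and
convection terms factor through the products `∇u · ∇v` and `v ∇u`, which Hölder's inequality in
space and then in time puts in `L¹(0, T; L¹(Ω))`. This space is paired with `L^∞(Ω_T)` by
`cylinderPairing`. The delicate point there is measurability in `t`, since a coefficient is a
function on the cylinder and not a strongly measurable function of time with values in `L^∞(Ω)`.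

The source term needs the embedding of `W₀^{1,q}(Ω)` in `C₀(Ω)`. The condition `p < d/(d-1)` is
equivalent to `q > d` for the conjugate exponent, and Morrey's inequality bounds the supremum of a
test function by its Sobolev norm. Density of test functions and completeness of `C₀(Ω)` extend this
to all of `W₀^{1,q}(Ω)` (`exists_isRepOn`). Since representatives are unique, `c0Rep` is linear and
bounded, and composing it with the duality of measures and `C₀(Ω)` gives the term. -/

noncomputable section

namespace ConvDiff

/-! ### Morrey's inequality on a finite-dimensional space -/

section Morrey

variable {E : Type*} [NormedAddCommGroup E] [NormedSpace ℝ E]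

/-- Fundamental theorem of calculus along the segment from `x` to `x + z`; the factor `‖z‖` is
dropped because it is at most one. -/
lemma enorm_sub_le_setLIntegral_fderiv {φ : E → ℝ} (hφ : ContDiff ℝ 1 φ) (x : E) {z : E}
    (hz : ‖z‖ ≤ 1) :
    ‖φ (x + z) - φ x‖ₑ ≤ ∫⁻ r in Ioc (0 : ℝ) 1, ‖fderiv ℝ φ (x + r • z)‖ₑ := by
  have hd : ∀ r : ℝ, HasDerivAt (fun r : ℝ => φ (x + r • z)) (fderiv ℝ φ (x + r • z) z) r := by
    intro r
    have h1 : HasDerivAt (fun r : ℝ => x + r • z) z r := by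
      simpa using ((hasDerivAt_id r).smul_const z).const_add x
    exact ((hφ.differentiable (by simp)) (x + r • z)).hasFDerivAt.comp_hasDerivAt r h1
  have hc : Continuous (fun r : ℝ => fderiv ℝ φ (x + r • z) z) :=
    ((hφ.continuous_fderiv (by simp)).comp (by fun_prop)).clm_apply continuous_const
  have hi := intervalIntegral.integral_eq_sub_of_hasDerivAt (a := 0) (b := 1)
    (fun r _ => hd r) (hc.intervalIntegrable 0 1)
  simp only [one_smul, zero_smul, add_zero] at hi
  rw [← hi, intervalIntegral.integral_of_le zero_le_one]
  refine (enorm_integral_le_lintegral_enorm _).trans (lintegral_mono fun r => ?_)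
  refine ((fderiv ℝ φ (x + r • z)).le_opENorm z).trans ?_
  have : ‖z‖ₑ ≤ 1 := by
    rw [← ofReal_norm]; exact ENNReal.ofReal_le_one.2 hz
  calc _ ≤ ‖fderiv ℝ φ (x + r • z)‖ₑ * 1 := by gcongr
    _ = _ := mul_one _

variable [FiniteDimensional ℝ E] [MeasurableSpace E] [BorelSpace E] (μ : Measure E)
  [μ.IsAddHaarMeasure]

/-- Translation preserves Haar measure, and dilation by `r` scales it by a power of `r` whose
exponent is the dimension. The resulting power of `r` decides the integrability over `(0, 1]` that
Morrey's inequality needs. -/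
lemma eLpNorm_comp_add_smul {F : Type*} [NormedAddCommGroup F] {q : ℝ≥0∞} (hq : q ≠ ⊤)
    {f : E → F} (hf : Continuous f) (x : E) {r : ℝ} (hr : 0 < r) :
    eLpNorm (fun z => f (x + r • z)) q μ =
      ENNReal.ofReal (r ^ (-(Module.finrank ℝ E / q.toReal))) * eLpNorm f q μ := by
  have h1 : eLpNorm (fun z => f (x + z)) q μ = eLpNorm f q μ :=
    eLpNorm_comp_measurePreserving hf.aestronglyMeasurable (measurePreserving_add_left μ x)
  have h2 : eLpNorm (fun z => f (x + r • z)) q μ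
      = eLpNorm (fun z => f (x + z)) q (μ.map (r • ·)) :=
    (eLpNorm_map_measure (g := fun z => f (x + z)) (by fun_prop) (by fun_prop)).symm
  have hpos : 0 < r ^ Module.finrank ℝ E := pow_pos hr _
  rw [h2, Measure.map_addHaar_smul μ hr.ne', eLpNorm_smul_measure_of_ne_top hq, h1, smul_eq_mul,
    abs_of_pos (inv_pos.2 hpos), ENNReal.ofReal_rpow_of_nonneg (inv_pos.2 hpos).le (by simp)]
  congr 2
  rw [← Real.rpow_natCast, ← Real.rpow_neg hr.le, ← Real.rpow_mul hr.le]
  congr 1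
  simp [div_eq_mul_inv]

lemma setLIntegral_enorm_le_eLpNorm {α F : Type*} [MeasurableSpace α] [NormedAddCommGroup F]
    {ν : Measure α} {q : ℝ≥0∞} (hq : 1 ≤ q) {f : α → F} (hf : AEStronglyMeasurable f ν)
    (s : Set α) :
    ∫⁻ z in s, ‖f z‖ₑ ∂ν ≤ eLpNorm f q ν * ν s ^ (1 - q.toReal⁻¹) := by
  rw [← eLpNorm_one_eq_lintegral_enorm]
  have := eLpNorm_le_eLpNorm_mul_rpow_measure_univ hq (hf.restrict (s := s))
  simp only [ENNReal.toReal_one, Measure.restrict_apply_univ, div_one, one_div] at this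
  refine this.trans ?_
  gcongr
  exact Measure.restrict_le_self

/-- Morrey's inequality in its supremum form. -/
theorem exists_enorm_le_eLpNorm_add_eLpNorm_fderiv {q : ℝ≥0∞} (hq1 : 1 ≤ q)
    (hq : (Module.finrank ℝ E : ℝ≥0∞) < q) (hq' : q ≠ ⊤) :
    ∃ C : ℝ≥0∞, C ≠ ⊤ ∧ ∀ φ : E → ℝ, ContDiff ℝ 1 φ → ∀ x,
      ‖φ x‖ₑ ≤ C * (eLpNorm φ q μ + eLpNorm (fderiv ℝ φ) q μ) := by
  set B : Set E := Metric.closedBall 0 1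
  set m := μ B
  have hm0 : m ≠ 0 := (Metric.measure_closedBall_pos μ 0 one_pos).ne'
  have hm : m ≠ ⊤ := measure_closedBall_lt_top.ne
  set s : ℝ := Module.finrank ℝ E / q.toReal
  have hs : s < 1 := by
    have hq0 : 0 < q.toReal := ENNReal.toReal_pos (by positivity) hq'
    rw [div_lt_one hq0]
    simpa using (ENNReal.toReal_lt_toReal (by simp) hq').2 hq
  set J : ℝ≥0∞ := ∫⁻ r in Ioc (0 : ℝ) 1, ENNReal.ofReal (r ^ (-s))
  -- This is where `q > dim E` enters: the exponent `-s` exceeds `-1`, so the power is integrable at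
  -- zero.
  have hJ : J ≠ ⊤ := by
    have h := (intervalIntegral.intervalIntegrable_rpow' (a := 0) (b := 1) (r := -s)
      (by linarith)).1
    exact h.lintegral_lt_top.ne
  set K : ℝ≥0∞ := m ^ (1 - q.toReal⁻¹)
  have hK : K ≠ ⊤ := ENNReal.rpow_ne_top_of_ne_zero hm0 hm
  refine ⟨m⁻¹ * (K * (1 + J)), by finiteness, fun φ hφ x => ?_⟩
  have hc := hφ.continuous
  have hc' := hφ.continuous_fderiv (by simp)
  have h1 : ∫⁻ z in B, ‖φ (x + z)‖ₑ ∂μ ≤ eLpNorm φ q μ * K := by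
    refine (setLIntegral_enorm_le_eLpNorm hq1 (f := fun z => φ (x + z))
      (by fun_prop) B).trans (le_of_eq ?_)
    rw [← eLpNorm_comp_measurePreserving hc.aestronglyMeasurable (measurePreserving_add_left μ x)]
    rfl
  -- Tonelli moves the segment parameter `r` outside. For fixed `r`, Hölder on the ball and the
  -- dilation formula give the full `L^q` norm of the derivative at the cost of `r ^ (-s)`.
  have h2 : ∫⁻ z in B, ‖φ (x + z) - φ x‖ₑ ∂μ ≤ eLpNorm (fderiv ℝ φ) q μ * K * J := by
    calc ∫⁻ z in B, ‖φ (x + z) - φ x‖ₑ ∂μ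
        ≤ ∫⁻ z in B, (∫⁻ r in Ioc (0 : ℝ) 1, ‖fderiv ℝ φ (x + r • z)‖ₑ) ∂μ :=
          setLIntegral_mono' Metric.isClosed_closedBall.measurableSet fun z hz =>
            enorm_sub_le_setLIntegral_fderiv hφ x (by simpa [B] using hz)
      _ = ∫⁻ r in Ioc (0 : ℝ) 1, ∫⁻ z in B, ‖fderiv ℝ φ (x + r • z)‖ₑ ∂μ := by
          apply lintegral_lintegral_swap
          apply Measurable.aemeasurable
          apply Continuous.measurable
          exact (hc'.comp (by fun_prop)).enorm
      _ ≤ ∫⁻ r in Ioc (0 : ℝ) 1, ENNReal.ofReal (r ^ (-s)) * (eLpNorm (fderiv ℝ φ) q μ * K) := by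
          refine setLIntegral_mono' measurableSet_Ioc fun r hr => ?_
          refine (setLIntegral_enorm_le_eLpNorm hq1 (f := fun z => fderiv ℝ φ (x + r • z))
            (hc'.comp (by fun_prop)).aestronglyMeasurable B).trans (le_of_eq ?_)
          rw [eLpNorm_comp_add_smul μ hq' hc' x hr.1, mul_assoc]
      _ = _ := by
          rw [lintegral_mul_const _ (by fun_prop), mul_comm]
  have h3 : m * ‖φ x‖ₑ ≤ K * (1 + J) * (eLpNorm φ q μ + eLpNorm (fderiv ℝ φ) q μ) := by
    calc m * ‖φ x‖ₑ = ∫⁻ z in B, ‖φ x‖ₑ ∂μ := by simp [m, mul_comm]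
      _ ≤ ∫⁻ z in B, (‖φ (x + z)‖ₑ + ‖φ (x + z) - φ x‖ₑ) ∂μ := by
          refine lintegral_mono fun z => ?_
          calc ‖φ x‖ₑ = ‖φ (x + z) - (φ (x + z) - φ x)‖ₑ := by rw [sub_sub_cancel]
            _ ≤ _ := enorm_sub_le
      _ = ∫⁻ z in B, ‖φ (x + z)‖ₑ ∂μ + ∫⁻ z in B, ‖φ (x + z) - φ x‖ₑ ∂μ :=
          lintegral_add_left (hc.comp (by fun_prop)).enorm.measurable _
      _ ≤ eLpNorm φ q μ * K + eLpNorm (fderiv ℝ φ) q μ * K * J := add_le_add h1 h2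
      -- Adding the two missing cross terms makes the sum factor.
      _ ≤ (eLpNorm φ q μ * K + eLpNorm (fderiv ℝ φ) q μ * K * J)
            + (eLpNorm (fderiv ℝ φ) q μ * K + eLpNorm φ q μ * K * J) := le_self_add
      _ = _ := by ring
  calc ‖φ x‖ₑ = m⁻¹ * (m * ‖φ x‖ₑ) := by
        rw [← mul_assoc, ENNReal.inv_mul_cancel hm0 hm, one_mul]
    _ ≤ m⁻¹ * (K * (1 + J) * (eLpNorm φ q μ + eLpNorm (fderiv ℝ φ) q μ)) := by gcongr
    _ = _ := by ring

end Morrey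

/-! ### The Sobolev embedding of `W₀^{1,q}(Ω)` in `C₀(Ω)` -/

section Embedding

variable {d : ℕ} {Ω : Set (Sp d)}

lemma IsTest.eq_zero {V : Type*} [NormedAddCommGroup V] [NormedSpace ℝ V] {Ω : Set V} {φ : V → ℝ}
    (hφ : IsTest Ω φ) {ξ : V} (hξ : ξ ∉ Ω) : φ ξ = 0 :=
  image_eq_zero_of_notMem_tsupport fun h => hξ (hφ.2.2 h)

lemma IsTest.support_gradient_subset {φ : Sp d → ℝ} (hφ : IsTest Ω φ) :
    Function.support (∇ φ) ⊆ Ω := by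
  intro ξ hξ
  refine hφ.2.2 (support_fderiv_subset ℝ (f := φ) fun h => hξ ?_)
  simp [gradient, h]

/-- Integration by parts: the gradient of a test function is its weak gradient. -/
lemma isWeakGradient_gradient {φ : Sp d → ℝ} (hφ : IsTest Ω φ) : IsWeakGradient Ω φ (∇ φ) := by
  intro ψ hψ
  have hφc := hφ.1.continuous
  have hψc := hψ.1.continuous
  have i1 : Integrable (fun ξ => φ ξ • ∇ ψ ξ) :=
    (hφc.smul (continuous_gradient hψ.1)).integrable_of_hasCompactSupport hφ.2.1.smul_right
  have i2 : Integrable (fun ξ => ψ ξ • ∇ φ ξ) :=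
    (hψc.smul (continuous_gradient hφ.1)).integrable_of_hasCompactSupport hψ.2.1.smul_right
  rw [setIntegral_eq_integral_of_forall_compl_eq_zero fun ξ hξ => by rw [hφ.eq_zero hξ, zero_smul],
    setIntegral_eq_integral_of_forall_compl_eq_zero fun ξ hξ => by rw [hψ.eq_zero hξ, zero_smul]]
  -- Pairing with a fixed vector `e` reduces the vector identity to scalar integration by parts in
  -- direction `e`, on the whole space because the supports lie in `Ω`.
  refine ext_inner_left ℝ fun e => ?_
  have key : ∀ f : Sp d → ℝ, ∀ ξ, fderiv ℝ f ξ e = ⟪e, ∇ f ξ⟫_ℝ := by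
    intro f ξ
    rw [real_inner_comm, gradient, InnerProductSpace.toDual_symm_apply]
  rw [inner_neg_right, ← integral_inner i1, ← integral_inner i2]
  have h := integral_mul_fderiv_eq_neg_fderiv_mul_of_integrable (μ := volume) (f := φ) (g := ψ)
    (v := e) ?_ ?_ ?_ (fun x _ => hφ.1.differentiable (by simp) x)
    (fun x _ => hψ.1.differentiable (by simp) x)
  · simp only [key] at h
    simp only [inner_smul_right, h, mul_comm]
  · have := i2.const_inner (𝕜 := ℝ) e
    simp only [inner_smul_right] at this
    simpa only [key, mul_comm] using this
  · have := i1.const_inner (𝕜 := ℝ) e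
    simpa only [key, inner_smul_right] using this
  · exact (hφc.mul hψc).integrable_of_hasCompactSupport hφ.2.1.mul_right

variable {q : ℝ≥0∞} [hq1 : Fact (1 ≤ q)]

/-- Uniqueness of weak gradients. -/
lemma W1.grad_ae_eq_gradient (hΩ : IsOpen Ω) (w : W1 q Ω) {φ : Sp d → ℝ} (hφ : IsTest Ω φ)
    (h : w.fn =ᵐ[volume.restrict Ω] φ) : w.grad =ᵐ[volume.restrict Ω] ∇ φ := by
  have hw : IsWeakGradient Ω w.fn w.grad := w.2
  have hg : LocallyIntegrable w.grad (volume.restrict Ω) :=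
    (Lp.memLp w.grad).locallyIntegrable hq1.out
  have hg' : LocallyIntegrable (∇ φ) (volume.restrict Ω) :=
    (continuous_gradient hφ.1).locallyIntegrable
  have hl : LocallyIntegrableOn (fun ξ => w.grad ξ - ∇ φ ξ) Ω (volume.restrict Ω) :=
    (hg.sub hg').locallyIntegrableOn Ω
  -- Fundamental lemma of the calculus of variations: both gradients give the same integral against
  -- every test function.
  have := hΩ.ae_eq_zero_of_integral_contDiff_smul_eq_zero hl fun ψ h1 h2 h3 => by
    have hψ : IsTest Ω ψ := ⟨h1, h2, h3⟩
    have e1 := hw ψ hψ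
    have e2 := isWeakGradient_gradient hφ ψ hψ
    have e3 : ∫ ξ in Ω, w.fn ξ • ∇ ψ ξ = ∫ ξ in Ω, φ ξ • ∇ ψ ξ :=
      integral_congr_ae (h.mono fun ξ hξ => by simp only [hξ])
    rw [e1, e2, neg_inj] at e3
    simp only [smul_sub]
    rw [integral_sub (integrable_test_smul q Ω _ hψ)
      (hg'.integrable_smul_left_of_hasCompactSupport hψ.1.continuous hψ.2.1), e3, sub_self]
  filter_upwards [this, ae_restrict_mem hΩ.measurableSet] with ξ h1 h2
  exact sub_eq_zero.1 (h1 h2)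

/-- `f` represents `g` on `Ω`. -/
def IsRepOn (Ω : Set (Sp d)) (f : C₀(Ω, ℝ)) (g : Sp d → ℝ) : Prop :=
  ∀ᵐ ξ ∂(volume.restrict Ω), ∀ hξ : ξ ∈ Ω, f ⟨ξ, hξ⟩ = g ξ

/-- Continuous functions that agree almost everywhere on an open set agree on it. The extensions by
zero only serve to turn functions on the subtype `Ω` into functions on the whole space, continuous
on `Ω`. -/
lemma IsRepOn.unique (hΩ : IsOpen Ω) {f f' : C₀(Ω, ℝ)} {g : Sp d → ℝ} (h : IsRepOn Ω f g)
    (h' : IsRepOn Ω f' g) : f = f' := by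
  have hext : ∀ (f : C₀(Ω, ℝ)) (ξ : Ω), Function.extend Subtype.val f 0 (ξ : Sp d) = f ξ :=
    fun f ξ => Subtype.val_injective.extend_apply _ _ _
  have hcont : ∀ f : C₀(Ω, ℝ), ContinuousOn (Function.extend Subtype.val f 0) Ω := by
    intro f
    rw [continuousOn_iff_continuous_domRestrict]
    convert f.continuous using 1
    ext ξ
    exact hext f ξ
  have hae : Function.extend Subtype.val f 0 =ᵐ[volume.restrict Ω]
      Function.extend Subtype.val f' 0 := by
    filter_upwards [h, h', ae_restrict_mem hΩ.measurableSet] with ξ h1 h2 hξ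
    rw [hext f ⟨ξ, hξ⟩, hext f' ⟨ξ, hξ⟩, h1 hξ, h2 hξ]
  ext ξ
  rw [← hext f, ← hext f']
  exact Measure.eqOn_open_of_ae_eq hae hΩ (hcont f) (hcont f') ξ.2

lemma IsRepOn.add {f f' : C₀(Ω, ℝ)} {w w' : W1 q Ω} (h : IsRepOn Ω f w.fn)
    (h' : IsRepOn Ω f' w'.fn) : IsRepOn Ω (f + f') (w + w').fn := by
  have : (w + w').fn = w.fn + w'.fn := map_add (W1.fnL q Ω) w w'
  rw [this]
  filter_upwards [h, h', Lp.coeFn_add w.fn w'.fn] with ξ h1 h2 h3 hξ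
  rw [h3, Pi.add_apply, ← h1 hξ, ← h2 hξ, ZeroAtInftyContinuousMap.add_apply]

lemma IsRepOn.smul (r : ℝ) {f : C₀(Ω, ℝ)} {w : W1 q Ω} (h : IsRepOn Ω f w.fn) :
    IsRepOn Ω (r • f) (r • w).fn := by
  have : (r • w).fn = r • w.fn := map_smul (W1.fnL q Ω) r w
  rw [this]
  filter_upwards [h, Lp.coeFn_smul r w.fn] with ξ h1 h3 hξ
  rw [h3, Pi.smul_apply, ← h1 hξ, ZeroAtInftyContinuousMap.smul_apply]

lemma IsRepOn.sub {f f' : C₀(Ω, ℝ)} {w w' : W1 q Ω} (h : IsRepOn Ω f w.fn)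
    (h' : IsRepOn Ω f' w'.fn) : IsRepOn Ω (f - f') (w - w').fn := by
  have h1 : f - f' = f + (-1 : ℝ) • f' := by
    ext
    simp [sub_eq_add_neg]
  have h2 : w - w' = w + (-1 : ℝ) • w' := by rw [neg_one_smul, sub_eq_add_neg]
  rw [h1, h2]
  exact h.add (h'.smul (-1))

/-- The restriction to `Ω` of a test function, as an element of `C₀(Ω)`. -/
def IsTest.toC0 {φ : Sp d → ℝ} (hφ : IsTest Ω φ) : C₀(Ω, ℝ) where
  toFun ξ := φ ξ
  continuous_toFun := hφ.1.continuous.comp continuous_subtype_val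
  zero_at_infty' := by
    have : HasCompactSupport fun ξ : Ω => φ ξ := by
      refine HasCompactSupport.intro (K := Subtype.val ⁻¹' tsupport φ) ?_ fun ξ hξ =>
        image_eq_zero_of_notMem_tsupport hξ
      -- The preimage in the subtype is compact because the support lies inside `Ω`, the range of
      -- the inclusion.
      exact Topology.IsInducing.subtypeVal.isCompact_preimage' hφ.2.1 (by simpa using hφ.2.2)
    exact this.is_zero_at_infty

/-- Test functions already form a linear space, so taking the span adds nothing and Morrey's
inequality applies to every element of it. -/
lemma exists_isTest_of_mem_span {w : W1 q Ω}
    (hw : w ∈ Submodule.span ℝ {w : W1 q Ω | ∃ φ : Sp d → ℝ, IsTest Ω φ ∧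
      w.fn =ᵐ[volume.restrict Ω] φ}) :
    ∃ φ : Sp d → ℝ, IsTest Ω φ ∧ w.fn =ᵐ[volume.restrict Ω] φ := by
  induction hw using Submodule.span_induction with
  | mem w h => exact h
  | zero =>
    refine ⟨0, ⟨contDiff_const, HasCompactSupport.zero, by simp [tsupport]⟩, ?_⟩
    have : (0 : W1 q Ω).fn = 0 := map_zero (W1.fnL q Ω)
    rw [this]
    exact Lp.coeFn_zero _ _ _
  | add w w' _ _ h h' =>
    obtain ⟨φ, h1, h2⟩ := h
    obtain ⟨φ', h1', h2'⟩ := h'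
    refine ⟨φ + φ', ⟨h1.1.add h1'.1, h1.2.1.add h1'.2.1,
      (tsupport_add φ φ').trans (union_subset h1.2.2 h1'.2.2)⟩, ?_⟩
    have : (w + w').fn = w.fn + w'.fn := map_add (W1.fnL q Ω) w w'
    rw [this]
    exact (Lp.coeFn_add _ _).trans (h2.add h2')
  | smul r w _ h =>
    obtain ⟨φ, h1, h2⟩ := h
    refine ⟨r • φ, ⟨contDiff_const.smul h1.1,
      h1.2.1.comp_left (g := fun y => r • y) (smul_zero r),
      (closure_mono (Function.support_const_smul_subset r φ)).trans h1.2.2⟩, ?_⟩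
    have : (r • w).fn = r • w.fn := map_smul (W1.fnL q Ω) r w
    rw [this]
    exact (Lp.coeFn_smul _ _).trans (h2.const_smul r)

lemma exists_isRepOn_of_mem_span (hΩ : IsOpen Ω) (hq : (d : ℝ≥0∞) < q) (hq' : q ≠ ⊤) :
    ∃ C : ℝ, ∀ w ∈ Submodule.span ℝ {w : W1 q Ω | ∃ φ : Sp d → ℝ, IsTest Ω φ ∧
      w.fn =ᵐ[volume.restrict Ω] φ}, ∃ f : C₀(Ω, ℝ), IsRepOn Ω f w.fn ∧ ‖f‖ ≤ C * ‖w‖ := by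
  obtain ⟨C, hC, h⟩ := exists_enorm_le_eLpNorm_add_eLpNorm_fderiv (volume : Measure (Sp d))
    hq1.out (by simpa using hq) hq'
  refine ⟨C.toReal * (‖W1.fnL q Ω‖ + ‖W1.gradL q Ω‖), fun w hw => ?_⟩
  obtain ⟨φ, hφ, hwφ⟩ := exists_isTest_of_mem_span hw
  have hg := w.grad_ae_eq_gradient hΩ hφ hwφ
  refine ⟨hφ.toC0, ?_, ?_⟩
  · filter_upwards [hwφ] with ξ hξ _
    exact hξ.symm
  -- Morrey's inequality lives on the whole space; the norms there equal those on `Ω` because `φ`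
  -- and its gradient vanish outside `Ω`.
  have e1 : eLpNorm φ q volume = ‖w.fn‖ₑ := by
    rw [Lp.enorm_def, eLpNorm_congr_ae hwφ]
    exact (eLpNorm_restrict_eq_of_support_subset
      fun ξ hξ => hφ.2.2 (subset_tsupport φ hξ)).symm
  have e2 : eLpNorm (fderiv ℝ φ) q volume = ‖w.grad‖ₑ := by
    rw [Lp.enorm_def, eLpNorm_congr_ae hg,
      eLpNorm_restrict_eq_of_support_subset hφ.support_gradient_subset]
    exact eLpNorm_congr_norm_ae (.of_forall fun ξ => by simp [gradient])
  rw [← ZeroAtInftyContinuousMap.norm_toBCF_eq_norm,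
    BoundedContinuousFunction.norm_le (by positivity)]
  intro ξ
  have h0 := h φ (hφ.1.of_le (by simp)) ξ
  rw [e1, e2] at h0
  have h1 := ENNReal.toReal_mono (by finiteness) h0
  rw [ENNReal.toReal_mul, ENNReal.toReal_add (by finiteness) (by finiteness)] at h1
  simp only [toReal_enorm] at h1
  refine h1.trans ?_
  rw [mul_assoc, add_mul]
  gcongr
  · exact (W1.fnL q Ω).le_opNorm w
  · exact (W1.gradL q Ω).le_opNorm w

/-- The Sobolev embedding `W₀^{1,q}(Ω) ⊆ C₀(Ω)` for `q > d`. -/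
lemma exists_isRepOn (hΩ : IsOpen Ω) (hq : (d : ℝ≥0∞) < q) (hq' : q ≠ ⊤) :
    ∃ C : ℝ, ∀ w : W10 q Ω, ∃ f : C₀(Ω, ℝ), IsRepOn Ω f w.fn ∧ ‖f‖ ≤ C * ‖w‖ := by
  obtain ⟨C, hC⟩ := exists_isRepOn_of_mem_span (Ω := Ω) hΩ hq hq'
  refine ⟨C, fun w => ?_⟩
  obtain ⟨x, hx, hxw⟩ := mem_closure_iff_seq_limit.1 w.2
  choose f hf hfn using fun n => hC (x n) (hx n)
  have hsub : ∀ n m, ‖f n - f m‖ ≤ C * ‖x n - x m‖ := by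
    -- The bound for `x n - x m` concerns a separately chosen representative; uniqueness identifies
    -- it with `f n - f m`.
    intro n m
    obtain ⟨f', h1, h2⟩ := hC (x n - x m) (Submodule.sub_mem _ (hx n) (hx m))
    rwa [← ((hf n).sub (hf m)).unique hΩ h1] at h2
  have hcauchy : CauchySeq f := by
    have hxc := hxw.cauchySeq
    rw [cauchySeq_iff_tendsto_dist_atTop_0] at hxc ⊢
    refine squeeze_zero (fun _ => dist_nonneg) (fun n => ?_) (by simpa using hxc.const_mul C)
    simpa [dist_eq_norm] using hsub n.1 n.2
  obtain ⟨F, hF⟩ := cauchySeq_tendsto_of_complete hcauchy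
  refine ⟨F, ?_, ?_⟩
  · have h1 : Tendsto (fun n => (x n).fn) atTop (𝓝 (W10.fn w)) :=
      ((W1.fnL q Ω).continuous.tendsto (w.1 : W1 q Ω)).comp hxw
    -- Uniform convergence gives the limit at every point, `L^q` convergence gives it almost
    -- everywhere along a subsequence; comparing them identifies `F` with `w`.
    obtain ⟨ns, hns, hae⟩ := (tendstoInMeasure_of_tendsto_Lp h1).exists_seq_tendsto_ae
    have hall : ∀ᵐ ξ ∂(volume.restrict Ω), ∀ n, ∀ hξ : ξ ∈ Ω, f n ⟨ξ, hξ⟩ = (x n).fn ξ :=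
      ae_all_iff.2 hf
    filter_upwards [hae, hall] with ξ h2 h3 hξ
    refine tendsto_nhds_unique ?_ h2
    have h4 : Tendsto (fun n => f n ⟨ξ, hξ⟩) atTop (𝓝 (F ⟨ξ, hξ⟩)) :=
      ((ZeroAtInftyContinuousMap.tendsto_iff_tendstoUniformly.1 hF).tendsto_at ⟨ξ, hξ⟩)
    refine (h4.comp hns.tendsto_atTop).congr fun n => h3 (ns n) hξ
  · exact le_of_tendsto_of_tendsto' hF.norm (hxw.norm.const_mul C) hfn

/-- For `q > d` the map to the representative in `C₀(Ω)` is linear and continuous. -/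
lemma exists_continuousLinearMap_c0Rep (hΩ : IsOpen Ω) (hq : (d : ℝ≥0∞) < q) (hq' : q ≠ ⊤) :
    ∃ R : W10 q Ω →L[ℝ] C₀(Ω, ℝ), ∀ w, R w = c0Rep w := by
  obtain ⟨C, hC⟩ := exists_isRepOn (Ω := Ω) hΩ hq hq'
  have hrep : ∀ w : W10 q Ω, IsRepOn Ω (c0Rep w) w.fn := by
    intro w
    have h : ∃ f : C₀(Ω, ℝ), IsRepOn Ω f w.fn := (hC w).imp fun _ h => h.1
    rw [c0Rep]
    exact (dif_pos h).symm ▸ h.choose_spec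
  -- `c0Rep` is defined by choice, so its linearity and its bound both come from uniqueness of the
  -- representative.
  refine ⟨LinearMap.mkContinuous ⟨⟨c0Rep, fun w w' => ?_⟩, fun r w => ?_⟩ C fun w => ?_,
    fun w => rfl⟩
  · exact (hrep (w + w')).unique hΩ ((hrep w).add (hrep w'))
  · exact (hrep (r • w)).unique hΩ ((hrep w).smul r)
  · obtain ⟨f, h1, h2⟩ := hC w
    rwa [h1.unique hΩ (hrep w)] at h2

end Embedding

/-! ### The duality between measures and `C₀(Ω)` -/

namespace RadonMeasure

variable {d : ℕ} {Ω : Set (Sp d)}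

lemma integrable_c0 (f : C₀(Ω, ℝ)) (ν : Measure Ω) [IsFiniteMeasure ν] : Integrable f ν :=
  f.toBCF.integrable ν

lemma norm_integral_c0_le (f : C₀(Ω, ℝ)) (ν : Measure Ω) [IsFiniteMeasure ν] :
    ‖∫ ξ, f ξ ∂ν‖ ≤ ‖f‖ * ν.real univ :=
  norm_integral_le_of_norm_le_const (.of_forall fun ξ => f.toBCF.norm_coe_le_norm ξ)

/-- Any splitting into finite positive measures may replace the Jordan decomposition: moving the
negative parts across gives an equality of positive measures, which can be integrated. This is
needed for additivity, since Jordan decompositions do not add. -/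
lemma pair_eq_of_eq_sub {μ : RadonMeasure Ω} (ν ν' : Measure Ω) [IsFiniteMeasure ν]
    [IsFiniteMeasure ν'] (h : μ.toSigned = ν.toSignedMeasure - ν'.toSignedMeasure)
    (f : C₀(Ω, ℝ)) : μ.pair f = (∫ ξ, f ξ ∂ν) - ∫ ξ, f ξ ∂ν' := by
  set P := μ.toSigned.toJordanDecomposition.posPart
  set N := μ.toSigned.toJordanDecomposition.negPart
  have h1 : P.toSignedMeasure - N.toSignedMeasure = ν.toSignedMeasure - ν'.toSignedMeasure := by
    rw [← h]
    exact SignedMeasure.toSignedMeasure_toJordanDecomposition _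
  have h2 : P + ν' = ν + N := by
    rw [← Measure.toSignedMeasure_eq_toSignedMeasure_iff, Measure.toSignedMeasure_add,
      Measure.toSignedMeasure_add]
    exact sub_eq_sub_iff_add_eq_add.1 h1
  have h3 := congrArg (fun m : Measure Ω => ∫ ξ, f ξ ∂m) h2
  simp only [integral_add_measure (integrable_c0 f _) (integrable_c0 f _)] at h3
  have : μ.pair f = (∫ ξ, f ξ ∂P) - ∫ ξ, f ξ ∂N := rfl
  linarith

lemma toSigned_eq_sub (μ : RadonMeasure Ω) : μ.toSigned =
    μ.toSigned.toJordanDecomposition.posPart.toSignedMeasure -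
      μ.toSigned.toJordanDecomposition.negPart.toSignedMeasure :=
  (SignedMeasure.toSignedMeasure_toJordanDecomposition _).symm

lemma pair_add (μ ν : RadonMeasure Ω) (f : C₀(Ω, ℝ)) :
    (μ + ν).pair f = μ.pair f + ν.pair f := by
  rw [pair_eq_of_eq_sub (μ := μ + ν)
    (μ.toSigned.toJordanDecomposition.posPart + ν.toSigned.toJordanDecomposition.posPart)
    (μ.toSigned.toJordanDecomposition.negPart + ν.toSigned.toJordanDecomposition.negPart)]
  · simp only [integral_add_measure (integrable_c0 f _) (integrable_c0 f _), pair]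
    ring
  · have : (μ + ν).toSigned = μ.toSigned + ν.toSigned := rfl
    rw [this, Measure.toSignedMeasure_add, Measure.toSignedMeasure_add, add_sub_add_comm,
      ← toSigned_eq_sub, ← toSigned_eq_sub]

lemma pair_smul (r : ℝ) (μ : RadonMeasure Ω) (f : C₀(Ω, ℝ)) :
    (r • μ).pair f = r * μ.pair f := by
  have h : (r • μ).toSigned.toJordanDecomposition = r • μ.toSigned.toJordanDecomposition :=
    SignedMeasure.toJordanDecomposition_smul_real _ _
  simp only [pair, h]
  rcases le_or_gt 0 r with hr | hr
  · rw [JordanDecomposition.real_smul_posPart_nonneg _ _ hr,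
      JordanDecomposition.real_smul_negPart_nonneg _ _ hr, integral_smul_nnreal_measure,
      integral_smul_nnreal_measure, NNReal.smul_def, NNReal.smul_def, Real.coe_toNNReal _ hr]
    simp only [smul_eq_mul]
    ring
  -- A negative factor exchanges the positive and negative parts.
  · rw [JordanDecomposition.real_smul_posPart_neg _ _ hr,
      JordanDecomposition.real_smul_negPart_neg _ _ hr, integral_smul_nnreal_measure,
      integral_smul_nnreal_measure, NNReal.smul_def, NNReal.smul_def,
      Real.coe_toNNReal _ (by linarith)]
    simp only [smul_eq_mul]
    ring

lemma norm_pair_le (μ : RadonMeasure Ω) (f : C₀(Ω, ℝ)) : ‖μ.pair f‖ ≤ ‖μ‖ * ‖f‖ := by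
  have h1 := norm_integral_c0_le f μ.toSigned.toJordanDecomposition.posPart
  have h2 := norm_integral_c0_le f μ.toSigned.toJordanDecomposition.negPart
  have h3 : ‖μ‖ = μ.toSigned.toJordanDecomposition.posPart.real univ +
      μ.toSigned.toJordanDecomposition.negPart.real univ := by
    rw [norm_def, SignedMeasure.totalVariation, measureReal_add_apply]
  calc ‖μ.pair f‖ ≤ _ := norm_sub_le _ _
    _ ≤ _ := add_le_add h1 h2
    _ = _ := by rw [h3]; ring

/-- The duality between `M(Ω)` and `C₀(Ω)` as a continuous bilinear map. -/
def pairL (Ω : Set (Sp d)) : RadonMeasure Ω →L[ℝ] C₀(Ω, ℝ) →L[ℝ] ℝ :=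
  LinearMap.mkContinuous₂
    (LinearMap.mk₂ ℝ pair pair_add pair_smul
      (fun μ f f' => by
        simp only [pair, ZeroAtInftyContinuousMap.add_apply]
        rw [integral_add (integrable_c0 f _) (integrable_c0 f' _),
          integral_add (integrable_c0 f _) (integrable_c0 f' _)]
        ring)
      (fun r μ f => by
        simp only [pair, ZeroAtInftyContinuousMap.smul_apply, integral_smul, smul_sub]))
    1 (fun μ f => by simpa using norm_pair_le μ f)

end RadonMeasure

/-! ### Pairing `L^∞(Ω_T)` with `L¹(0, T; L¹(Ω))` -/

section CylinderPairing

variable {d : ℕ} {Ω : Set (Sp d)} {T : ℝ} {V : Type} [NormedAddCommGroup V]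

/-- Fubini for null sets. The swap is needed because the cylinder lists space before time, whereas
slices are taken at fixed time. -/
lemma ae_ae_cylinder {P : Sp d × ℝ → Prop} (h : ∀ᵐ x ∂(cylinderMeasure Ω T), P x) :
    ∀ᵐ t ∂(timeMeasure T), ∀ᵐ ξ ∂(volume.restrict Ω), P (ξ, t) := by
  have h1 : cylinderMeasure Ω T = (volume.restrict Ω).prod (timeMeasure T) :=
    (Measure.prod_restrict Ω (Ioo 0 T)).symm
  rw [h1] at h
  exact Measure.ae_ae_of_ae_prod (Measure.measurePreserving_swap.quasiMeasurePreserving.ae h)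

lemma ae_ae_norm_le (k : LInfty Ω T V) :
    ∀ᵐ t ∂(timeMeasure T), ∀ᵐ ξ ∂(volume.restrict Ω), ‖k (ξ, t)‖ ≤ ‖k‖ := by
  refine ae_ae_cylinder (P := fun x => ‖k x‖ ≤ ‖k‖) ?_
  filter_upwards [ae_le_eLpNormEssSup (f := k) (μ := cylinderMeasure Ω T)] with x hx
  rw [Lp.norm_def, eLpNorm_exponent_top, ← toReal_enorm]
  refine ENNReal.toReal_mono ?_ hx
  rw [← eLpNorm_exponent_top]
  exact Lp.eLpNorm_ne_top k

variable [InnerProductSpace ℝ V]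

/-- The pairing over `Ω` of the time slice `k(·, t)` with `G ∈ L¹(Ω; V)`. -/
def slicePair (k : LInfty Ω T V) (t : ℝ) (G : Lp V 1 (volume.restrict Ω)) : ℝ :=
  ∫ ξ in Ω, ⟪k (ξ, t), G ξ⟫_ℝ

lemma integrable_slice {k : LInfty Ω T V} {t : ℝ}
    (ht : ∀ᵐ ξ ∂(volume.restrict Ω), ‖k (ξ, t)‖ ≤ ‖k‖) (G : Lp V 1 (volume.restrict Ω)) :
    Integrable (fun ξ => ⟪k (ξ, t), G ξ⟫_ℝ) (volume.restrict Ω) :=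
  (innerSL ℝ (E := V)).integrable_of_bilin_of_bdd_left ‖k‖
    ((Lp.stronglyMeasurable k).comp_measurable measurable_prodMk_right).aestronglyMeasurable ht
    (L1.integrable_coeFn G)

lemma norm_slicePair_le {k : LInfty Ω T V} {t : ℝ}
    (ht : ∀ᵐ ξ ∂(volume.restrict Ω), ‖k (ξ, t)‖ ≤ ‖k‖) (G : Lp V 1 (volume.restrict Ω)) :
    ‖slicePair k t G‖ ≤ ‖k‖ * ‖G‖ := by
  rw [L1.norm_eq_integral_norm, ← integral_const_mul]
  refine norm_integral_le_of_norm_le ((L1.integrable_coeFn G).norm.const_mul _) ?_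
  filter_upwards [ht] with ξ hξ
  exact (norm_inner_le_norm _ _).trans (by gcongr)

lemma slicePair_add_right {k : LInfty Ω T V} {t : ℝ}
    (ht : ∀ᵐ ξ ∂(volume.restrict Ω), ‖k (ξ, t)‖ ≤ ‖k‖) (G G' : Lp V 1 (volume.restrict Ω)) :
    slicePair k t (G + G') = slicePair k t G + slicePair k t G' := by
  rw [slicePair, slicePair, slicePair, ← integral_add (integrable_slice ht G)
    (integrable_slice ht G')]
  refine integral_congr_ae ?_
  filter_upwards [Lp.coeFn_add G G'] with ξ h
  rw [h, Pi.add_apply, inner_add_right]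

lemma slicePair_smul_right (k : LInfty Ω T V) (t : ℝ) (r : ℝ) (G : Lp V 1 (volume.restrict Ω)) :
    slicePair k t (r • G) = r * slicePair k t G := by
  rw [slicePair, slicePair, ← integral_const_mul]
  refine integral_congr_ae ?_
  filter_upwards [Lp.coeFn_smul r G] with ξ h
  rw [h, Pi.smul_apply, inner_smul_right]

lemma measurable_slicePair (k : LInfty Ω T V) (G : Lp V 1 (volume.restrict Ω)) :
    Measurable fun t => slicePair k t G := by
  have h : StronglyMeasurable fun x : Sp d × ℝ => ⟪k x, G x.1⟫_ℝ :=
    (Lp.stronglyMeasurable k).inner ((Lp.stronglyMeasurable G).comp_measurable measurable_fst)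
  exact (h.integral_prod_left' (μ := volume.restrict Ω)).measurable

/-- For a fixed `G` the pairing is measurable in `t` by joint measurability, hence also along simple
functions of time. Simple approximations of `F` then suffice, because for almost every `t` the slice
of `k` is bounded and the pairing is continuous in `G`. -/
lemma aestronglyMeasurable_slicePair (k : LInfty Ω T V)
    (F : Lp (Lp V 1 (volume.restrict Ω)) 1 (timeMeasure T)) :
    AEStronglyMeasurable (fun t => slicePair k t (F t)) (timeMeasure T) := by
  have hF := Lp.stronglyMeasurable F
  refine aestronglyMeasurable_of_tendsto_ae atTop
    (f := fun n t => slicePair k t (hF.approx n t)) (fun n => ?_) ?_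
  · exact (SimpleFunc.measurable_bind (hF.approx n) (fun G t => slicePair k t G)
      (measurable_slicePair k)).aestronglyMeasurable
  · filter_upwards [ae_ae_norm_le k] with t ht
    have hc : Continuous (slicePair k t) := by
      let L : Lp V 1 (volume.restrict Ω) →L[ℝ] ℝ := LinearMap.mkContinuous
        ⟨⟨slicePair k t, slicePair_add_right ht⟩, slicePair_smul_right k t⟩ ‖k‖
        (norm_slicePair_le ht)
      exact L.continuous
    exact (hc.tendsto _).comp (hF.tendsto_approx t)

lemma integrable_slicePair (k : LInfty Ω T V)
    (F : Lp (Lp V 1 (volume.restrict Ω)) 1 (timeMeasure T)) :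
    Integrable (fun t => slicePair k t (F t)) (timeMeasure T) := by
  refine ((L1.integrable_coeFn F).norm.const_mul ‖k‖).mono' (aestronglyMeasurable_slicePair k F) ?_
  filter_upwards [ae_ae_norm_le k] with t ht
  exact norm_slicePair_le ht _

/-- `∫_{Ω_T} k · F dξ dt` for `k ∈ L^∞(Ω_T; V)` and `F ∈ L¹(0, T; L¹(Ω; V))`. -/
def cylinderPair (k : LInfty Ω T V) (F : Lp (Lp V 1 (volume.restrict Ω)) 1 (timeMeasure T)) : ℝ :=
  ∫ t in Ioo 0 T, slicePair k t (F t)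

lemma cylinderPair_add_left (k k' : LInfty Ω T V)
    (F : Lp (Lp V 1 (volume.restrict Ω)) 1 (timeMeasure T)) :
    cylinderPair (k + k') F = cylinderPair k F + cylinderPair k' F := by
  rw [cylinderPair, cylinderPair, cylinderPair,
    ← integral_add (integrable_slicePair k F) (integrable_slicePair k' F)]
  refine integral_congr_ae ?_
  filter_upwards [ae_ae_norm_le k, ae_ae_norm_le k', ae_ae_cylinder (Lp.coeFn_add k k')]
    with t h h' h2
  simp only [slicePair]
  rw [← integral_add (integrable_slice h _) (integrable_slice h' _)]
  refine integral_congr_ae ?_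
  filter_upwards [h2] with ξ hξ
  rw [hξ, Pi.add_apply, inner_add_left]

lemma cylinderPair_smul_left (r : ℝ) (k : LInfty Ω T V)
    (F : Lp (Lp V 1 (volume.restrict Ω)) 1 (timeMeasure T)) :
    cylinderPair (r • k) F = r • cylinderPair k F := by
  rw [cylinderPair, cylinderPair, ← integral_smul]
  refine integral_congr_ae ?_
  filter_upwards [ae_ae_cylinder (Lp.coeFn_smul r k)] with t h2
  simp only [slicePair]
  rw [← integral_smul]
  refine integral_congr_ae ?_
  filter_upwards [h2] with ξ hξ
  rw [hξ, Pi.smul_apply, real_inner_smul_left, smul_eq_mul]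

lemma cylinderPair_add_right (k : LInfty Ω T V)
    (F F' : Lp (Lp V 1 (volume.restrict Ω)) 1 (timeMeasure T)) :
    cylinderPair k (F + F') = cylinderPair k F + cylinderPair k F' := by
  rw [cylinderPair, cylinderPair, cylinderPair,
    ← integral_add (integrable_slicePair k F) (integrable_slicePair k F')]
  refine integral_congr_ae ?_
  filter_upwards [ae_ae_norm_le k, Lp.coeFn_add F F'] with t h h2
  rw [h2, Pi.add_apply, slicePair_add_right h]

lemma cylinderPair_smul_right (r : ℝ) (k : LInfty Ω T V)
    (F : Lp (Lp V 1 (volume.restrict Ω)) 1 (timeMeasure T)) :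
    cylinderPair k (r • F) = r • cylinderPair k F := by
  rw [cylinderPair, cylinderPair, ← integral_smul]
  refine integral_congr_ae ?_
  filter_upwards [Lp.coeFn_smul r F] with t h2
  rw [h2, Pi.smul_apply, slicePair_smul_right, smul_eq_mul]

lemma norm_cylinderPair_le (k : LInfty Ω T V)
    (F : Lp (Lp V 1 (volume.restrict Ω)) 1 (timeMeasure T)) :
    ‖cylinderPair k F‖ ≤ 1 * ‖k‖ * ‖F‖ := by
  rw [one_mul, L1.norm_eq_integral_norm, ← integral_const_mul]
  refine norm_integral_le_of_norm_le ((L1.integrable_coeFn F).norm.const_mul _) ?_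
  filter_upwards [ae_ae_norm_le k] with t ht
  exact norm_slicePair_le ht _

variable (Ω T V) in
/-- The pairing of `L^∞(Ω_T; V)` with `L¹(0, T; L¹(Ω; V))` as a continuous bilinear map. -/
def cylinderPairing :
    LInfty Ω T V →L[ℝ] Lp (Lp V 1 (volume.restrict Ω)) 1 (timeMeasure T) →L[ℝ] ℝ :=
  LinearMap.mkContinuous₂
    (LinearMap.mk₂ ℝ cylinderPair cylinderPair_add_left cylinderPair_smul_left
      cylinderPair_add_right cylinderPair_smul_right)
    1 norm_cylinderPair_le

end CylinderPairing

/-! ### The conjugate exponent exceeds the dimension -/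

lemma lt_and_ne_top_of_holderConjugate {d : ℕ} {p q : ℝ≥0∞} [hpq : p.HolderConjugate q]
    (hp : 1 < p) (hp' : p < (d : ℝ≥0∞) / ((d : ℝ≥0∞) - 1)) : (d : ℝ≥0∞) < q ∧ q ≠ ⊤ := by
  have h := ENNReal.HolderConjugate.inv_add_inv_eq_one p q
  have hq : q ≠ ⊤ := by
    rintro rfl
    rw [ENNReal.inv_top, add_zero, ENNReal.inv_eq_one] at h
    exact hp.ne' h
  refine ⟨?_, hq⟩
  have hpt : p ≠ ⊤ := hp'.ne_top
  have hq0 : q ≠ 0 := by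
    rintro rfl
    simp at h
  have hp0 : p ≠ 0 := (zero_lt_one.trans hp).ne'
  have hmul : p * ((d : ℝ≥0∞) - 1) < d := ENNReal.mul_lt_of_lt_div hp'
  lift p to ℝ≥0 using hpt
  lift q to ℝ≥0 using hq
  have hp0' : p ≠ 0 := by simpa using hp0
  have hq0' : q ≠ 0 := by simpa using hq0
  rw [← ENNReal.coe_inv hp0', ← ENNReal.coe_inv hq0'] at h
  have h' : (p : ℝ)⁻¹ + (q : ℝ)⁻¹ = 1 := by exact_mod_cast h
  have hP : (1 : ℝ) < p := by exact_mod_cast hp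
  have hQ0 : (q : ℝ) ≠ 0 := by exact_mod_cast hq0'
  have hPQ : (q : ℝ) + p = p * q := by
    field_simp at h'
    linarith
  have hm : (p : ℝ) * ((d : ℝ) - 1) < d := by
    rcases Nat.eq_zero_or_pos d with rfl | hd
    · simpa using hP.trans' one_pos
    -- Writing `d = n + 1` turns the truncated subtraction in `ℝ≥0∞` into a genuine one. For `d = 1`
    -- the quotient `1 / 0` is `⊤`, so the hypothesis on `p` just says that `p` is finite.
    · obtain ⟨n, rfl⟩ : ∃ n, d = n + 1 := ⟨d - 1, by omega⟩
      have e : ((n + 1 : ℕ) : ℝ≥0∞) - 1 = n := by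
        rw [Nat.cast_add, Nat.cast_one]
        exact ENNReal.add_sub_cancel_right (by simp)
      rw [e] at hmul
      have : p * (n : ℝ≥0) < ((n + 1 : ℕ) : ℝ≥0) := by exact_mod_cast hmul
      have : (p : ℝ) * n < ((n + 1 : ℕ) : ℝ) := by exact_mod_cast this
      simpa using this
  have : (d : ℝ) < q := by
    -- By conjugacy `q (p - 1) = p`, while `p (d - 1) < d` reads `d (p - 1) < p`.
    have : ((d : ℝ) - q) * (p - 1) < 0 := by nlinarith
    nlinarith
  exact_mod_cast this

/-! ### The terms of the weak form as bounded bilinear maps -/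

section Terms

variable {d : ℕ} (p q : ℝ≥0∞) [Fact (1 ≤ p)] [Fact (1 ≤ q)] (Ω Γ₁ : Set (Sp d)) (T : ℝ)

/-- The pairing `∫_0^T ⟨u', v⟩ dt` as a continuous bilinear map. -/
def timeForm : Lp (StrongDual ℝ (W10 q Ω)) 2 (timeMeasure T) →L[ℝ]
    Lp (W10 q Ω) 2 (timeMeasure T) →L[ℝ] ℝ :=
  (ContinuousLinearMap.id ℝ (StrongDual ℝ (W10 q Ω))).lpPairing (timeMeasure T) 2 2

/-- The pairing `∫_{Σ₁} τ v dσ dt` as a continuous bilinear map. -/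
def boundaryForm : BoundarySpace Γ₁ T →L[ℝ] BoundarySpace Γ₁ T →L[ℝ] ℝ :=
  ((ContinuousLinearMap.lsmul ℝ ℝ).lpPairing (surfaceMeasure Γ₁) 2 2).lpPairing (timeMeasure T) 2 2

/-- The product `∇u · ∇v ∈ L¹(Ω)` as a continuous bilinear map. -/
def sliceGradProduct [p.HolderConjugate q] :
    W1 p Ω →L[ℝ] W10 q Ω →L[ℝ] Lp ℝ 1 (volume.restrict Ω) :=
  ((innerSL ℝ (E := Sp d)).holderL (volume.restrict Ω) p q 1).bilinearComp
    (W1.gradL p Ω) ((W1.gradL q Ω).comp (W10.inclL q Ω))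

/-- The product `v ∇u ∈ L¹(Ω; ℝ^d)` as a continuous bilinear map. -/
def sliceSmulGradProduct [p.HolderConjugate q] :
    W1 p Ω →L[ℝ] W10 q Ω →L[ℝ] Lp (Sp d) 1 (volume.restrict Ω) :=
  ((ContinuousLinearMap.lsmul ℝ ℝ (E := Sp d)).flip.holderL (volume.restrict Ω) p q 1).bilinearComp
    (W1.gradL p Ω) ((W1.fnL q Ω).comp (W10.inclL q Ω))

/-- The product `∇u · ∇v` as a continuous bilinear map with values in `L¹(0, T; L¹(Ω))`. -/
def gradProduct [p.HolderConjugate q] : Lp (W1 p Ω) 2 (timeMeasure T) →L[ℝ]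
    Lp (W10 q Ω) 2 (timeMeasure T) →L[ℝ] Lp (Lp ℝ 1 (volume.restrict Ω)) 1 (timeMeasure T) :=
  (sliceGradProduct p q Ω).holderL (timeMeasure T) 2 2 1

/-- The product `v ∇u` as a continuous bilinear map with values in `L¹(0, T; L¹(Ω; ℝ^d))`. -/
def smulGradProduct [p.HolderConjugate q] : Lp (W1 p Ω) 2 (timeMeasure T) →L[ℝ]
    Lp (W10 q Ω) 2 (timeMeasure T) →L[ℝ]
      Lp (Lp (Sp d) 1 (volume.restrict Ω)) 1 (timeMeasure T) :=
  (sliceSmulGradProduct p q Ω).holderL (timeMeasure T) 2 2 1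

variable {p q Ω Γ₁ T}

lemma timeForm_apply (u' : Lp (StrongDual ℝ (W10 q Ω)) 2 (timeMeasure T))
    (v : Lp (W10 q Ω) 2 (timeMeasure T)) : timeForm q Ω T u' v = timeTerm u' v :=
  ContinuousLinearMap.lpPairing_eq_integral _ u' v

lemma boundaryForm_apply (τ v : BoundarySpace Γ₁ T) :
    boundaryForm Γ₁ T τ v = boundaryTerm τ v := by
  refine (ContinuousLinearMap.lpPairing_eq_integral _ τ v).trans ?_
  exact integral_congr_ae (.of_forall fun t =>
    ContinuousLinearMap.lpPairing_eq_integral (ContinuousLinearMap.lsmul ℝ ℝ) (τ t) (v t))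

lemma coeFn_sliceGradProduct [p.HolderConjugate q] (u : W1 p Ω) (v : W10 q Ω) :
    sliceGradProduct p q Ω u v =ᵐ[volume.restrict Ω] fun ξ => ⟪u.grad ξ, v.grad ξ⟫_ℝ :=
  ContinuousLinearMap.coeFn_holder (r := 1) (innerSL ℝ (E := Sp d)) u.grad v.grad

lemma coeFn_sliceSmulGradProduct [p.HolderConjugate q] (u : W1 p Ω) (v : W10 q Ω) :
    sliceSmulGradProduct p q Ω u v =ᵐ[volume.restrict Ω] fun ξ => v.fn ξ • u.grad ξ :=
  ContinuousLinearMap.coeFn_holder (r := 1) (ContinuousLinearMap.lsmul ℝ ℝ (E := Sp d)).flip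
    u.grad v.fn

lemma coeFn_gradProduct [p.HolderConjugate q] (u : Lp (W1 p Ω) 2 (timeMeasure T))
    (v : Lp (W10 q Ω) 2 (timeMeasure T)) :
    gradProduct p q Ω T u v =ᵐ[timeMeasure T] fun t => sliceGradProduct p q Ω (u t) (v t) :=
  ContinuousLinearMap.coeFn_holder (r := 1) (sliceGradProduct p q Ω) u v

lemma coeFn_smulGradProduct [p.HolderConjugate q] (u : Lp (W1 p Ω) 2 (timeMeasure T))
    (v : Lp (W10 q Ω) 2 (timeMeasure T)) :
    smulGradProduct p q Ω T u v =ᵐ[timeMeasure T]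
      fun t => sliceSmulGradProduct p q Ω (u t) (v t) :=
  ContinuousLinearMap.coeFn_holder (r := 1) (sliceSmulGradProduct p q Ω) u v

lemma cylinderPair_gradProduct [p.HolderConjugate q] (k : LInfty Ω T ℝ)
    (u : Lp (W1 p Ω) 2 (timeMeasure T)) (v : Lp (W10 q Ω) 2 (timeMeasure T)) :
    cylinderPair k (gradProduct p q Ω T u v) = diffusionTerm k u v := by
  unfold cylinderPair diffusionTerm
  refine integral_congr_ae ?_
  filter_upwards [coeFn_gradProduct u v] with t ht
  rw [ht, slicePair]
  refine integral_congr_ae ?_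
  filter_upwards [coeFn_sliceGradProduct (u t) (v t)] with ξ hξ
  rw [hξ]
  exact mul_comm _ _

lemma cylinderPair_smulGradProduct [p.HolderConjugate q] (c : LInfty Ω T (Sp d))
    (u : Lp (W1 p Ω) 2 (timeMeasure T)) (v : Lp (W10 q Ω) 2 (timeMeasure T)) :
    cylinderPair c (smulGradProduct p q Ω T u v) = convectionTerm c u v := by
  unfold cylinderPair convectionTerm
  refine integral_congr_ae ?_
  filter_upwards [coeFn_smulGradProduct u v] with t ht
  rw [ht, slicePair]
  refine integral_congr_ae ?_
  filter_upwards [coeFn_sliceSmulGradProduct (u t) (v t)] with ξ hξ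
  rw [hξ, real_inner_smul_right, mul_comm]

/-- For `q > d` the pairing `∫_0^T ⟨μ, v(t)⟩ dt` is a continuous bilinear map. -/
lemma exists_sourceForm (hΩ : IsOpen Ω) (hq : (d : ℝ≥0∞) < q) (hq' : q ≠ ⊤) :
    ∃ S : RadonMeasure Ω →L[ℝ] Lp (W10 q Ω) 2 (timeMeasure T) →L[ℝ] ℝ,
      ∀ μ v, S μ v = sourceTerm μ v := by
  obtain ⟨R, hR⟩ := exists_continuousLinearMap_c0Rep (Ω := Ω) hΩ hq hq'
  -- The measure is viewed as a constant function in `L²(0, T; M(Ω))`, since `(0, T)` has finite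
  -- measure; the Hölder pairing in time then applies.
  refine ⟨(((RadonMeasure.pairL Ω).bilinearComp (.id ℝ _) R).lpPairing (timeMeasure T) 2 2).comp
    (Lp.constL 2 (timeMeasure T) ℝ), fun μ v => ?_⟩
  refine (ContinuousLinearMap.lpPairing_eq_integral _ (Lp.const 2 (timeMeasure T) μ) v).trans ?_
  refine integral_congr_ae ?_
  filter_upwards [Lp.coeFn_const 2 (timeMeasure T) μ] with t ht
  rw [ht, ContinuousLinearMap.bilinearComp_apply, hR]
  rfl

end Terms

/-! ### The operators whose sum is `e` -/

section StateProjections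

variable {d : ℕ} (p q : ℝ≥0∞) [Fact (1 ≤ p)] [Fact (1 ≤ q)] [p.HolderConjugate q]
  (Ω Γ₁ : Set (Sp d)) (T : ℝ)

/-- The inclusion of the state space in `L²(0, T; W^{1,p}(Ω))`. -/
def StateSpace.fnL : StateSpace p q Ω Γ₁ T →L[ℝ] Lp (W1 p Ω) 2 (timeMeasure T) :=
  (ContinuousLinearMap.fst ℝ _ _).comp (stateSubmodule p q Ω Γ₁ T).subtypeL

/-- The time derivative as a continuous linear map on the state space. -/
def StateSpace.dtL : StateSpace p q Ω Γ₁ T →L[ℝ]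
    Lp (StrongDual ℝ (W10 q Ω)) 2 (timeMeasure T) :=
  ((ContinuousLinearMap.fst ℝ _ _).comp (ContinuousLinearMap.snd ℝ _ _)).comp
    (stateSubmodule p q Ω Γ₁ T).subtypeL

/-- The trace as a continuous linear map on the state space. -/
def StateSpace.traceL : StateSpace p q Ω Γ₁ T →L[ℝ] BoundarySpace Γ₁ T :=
  ((ContinuousLinearMap.snd ℝ _ _).comp (ContinuousLinearMap.snd ℝ _ _)).comp
    (stateSubmodule p q Ω Γ₁ T).subtypeL

end StateProjections

section WeakFormMaps

variable {d : ℕ} {p q : ℝ≥0∞} [Fact (1 ≤ p)] [Fact (1 ≤ q)] [p.HolderConjugate q]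
  {Ω Γ₁ : Set (Sp d)} {T : ℝ}

/-- The part of the weak form that is linear in the state, as an operator on the state space. -/
def stateOperator (k : LInfty Ω T ℝ) (c : LInfty Ω T (Sp d)) :
    StateSpace p q Ω Γ₁ T →L[ℝ] StrongDual ℝ (TestSpace q Ω Γ₁ T) :=
  -(timeForm q Ω T).bilinearComp (StateSpace.dtL p q Ω Γ₁ T) (.fst ℝ _ _)
    + (((cylinderPairing Ω T ℝ k).postcomp _).comp
        (gradProduct p q Ω T)).bilinearComp (StateSpace.fnL p q Ω Γ₁ T) (.fst ℝ _ _)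
    + (((cylinderPairing Ω T (Sp d) c).postcomp _).comp
        (smulGradProduct p q Ω T)).bilinearComp (StateSpace.fnL p q Ω Γ₁ T) (.fst ℝ _ _)
    + (boundaryForm Γ₁ T).bilinearComp (StateSpace.traceL p q Ω Γ₁ T) (.snd ℝ _ _)

lemma stateOperator_apply (k : LInfty Ω T ℝ) (c : LInfty Ω T (Sp d))
    (w : StateSpace p q Ω Γ₁ T) (v : TestSpace q Ω Γ₁ T) :
    stateOperator k c w v = -timeTerm w.dt v.1 + diffusionTerm k w.fn v.1
      + convectionTerm c w.fn v.1 + boundaryTerm w.trace v.2 := by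
  have h₁ := timeForm_apply w.dt v.1
  have h₂ := cylinderPair_gradProduct k w.fn v.1
  have h₃ := cylinderPair_smulGradProduct c w.fn v.1
  have h₄ := boundaryForm_apply w.trace v.2
  -- The operator applied to `w` and `v` unfolds by definition to these four pairings, so only the
  -- value of each has to be rewritten.
  exact congrArg₂ (· + ·) (congrArg₂ (· + ·) (congrArg₂ (· + ·) (congrArg Neg.neg h₁) h₂) h₃) h₄

/-- The diffusion term as an operator acting on the diffusion coefficient. -/
def diffusionOperator (u : StateSpace p q Ω Γ₁ T) :
    LInfty Ω T ℝ →L[ℝ] StrongDual ℝ (TestSpace q Ω Γ₁ T) :=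
  (cylinderPairing Ω T ℝ).bilinearComp (.id ℝ _)
    ((gradProduct p q Ω T u.fn).comp (.fst ℝ _ (BoundarySpace Γ₁ T)))

lemma diffusionOperator_apply (u : StateSpace p q Ω Γ₁ T) (h : LInfty Ω T ℝ)
    (v : TestSpace q Ω Γ₁ T) : diffusionOperator u h v = diffusionTerm h u.fn v.1 :=
  cylinderPair_gradProduct h u.fn v.1

/-- The convection term as an operator acting on the velocity. -/
def convectionOperator (u : StateSpace p q Ω Γ₁ T) :
    LInfty Ω T (Sp d) →L[ℝ] StrongDual ℝ (TestSpace q Ω Γ₁ T) :=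
  (cylinderPairing Ω T (Sp d)).bilinearComp (.id ℝ _)
    ((smulGradProduct p q Ω T u.fn).comp (.fst ℝ _ (BoundarySpace Γ₁ T)))

lemma convectionOperator_apply (u : StateSpace p q Ω Γ₁ T) (b : LInfty Ω T (Sp d))
    (v : TestSpace q Ω Γ₁ T) : convectionOperator u b v = convectionTerm b u.fn v.1 :=
  cylinderPair_smulGradProduct b u.fn v.1

lemma boundaryTerm_sub (τ g v : BoundarySpace Γ₁ T) :
    boundaryTerm (τ - g) v = boundaryTerm τ v - boundaryTerm g v := by
  simp only [← boundaryForm_apply, map_sub, sub_apply]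

/-- Such an `f` is `D` plus a constant. Stating the condition through increments lets the terms
independent of the varied argument cancel in each application. -/
lemma hasFDerivAt_of_sub_eq {E F : Type*} [NormedAddCommGroup E] [NormedSpace ℝ E]
    [NormedAddCommGroup F] [NormedSpace ℝ F] {f : E → F} (D : E →L[ℝ] F)
    (h : ∀ x y, f x - f y = D x - D y) (x : E) : HasFDerivAt f D x := by
  have : f = fun y => D y + (f x - D x) := by
    ext1 y
    rw [add_sub_left_comm, ← h y x, add_sub_cancel]
  rw [this]
  exact D.hasFDerivAt.add_const _

end WeakFormMaps

end ConvDiff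

end

/-! ### Assembly of the theorem -/

open ConvDiff in
theorem mainTheorem7 {d : ℕ} (hd : 1 ≤ d) (hd' : d ≤ 3)
    (Ω Γ₁ : Set (Sp d)) (hΩ : IsBoundedLipschitzDomain Ω)
    (hΓ : Γ₁ ⊆ frontier Ω) (hΓm : MeasurableSet Γ₁) (T : ℝ) (hT : 0 < T)
    (p q : ℝ≥0∞) [Fact (1 ≤ p)] [Fact (1 ≤ q)] [p.HolderConjugate q]
    (hp : 1 < p) (hp' : p < (d : ℝ≥0∞) / ((d : ℝ≥0∞) - 1))
    (g : BoundarySpace Γ₁ T) :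
    ∃ e : StateSpace p q Ω Γ₁ T × ParamSpace Ω T → StrongDual ℝ (TestSpace q Ω Γ₁ T),
      (∀ u μ k c v, e (u, μ, k, c) v = weakForm g u μ k c v) ∧
      ∀ (u : StateSpace p q Ω Γ₁ T) (μ : RadonMeasure Ω) (k : LInfty Ω T ℝ)
        (c : LInfty Ω T (Sp d)),
        (∃ D : StateSpace p q Ω Γ₁ T →L[ℝ] StrongDual ℝ (TestSpace q Ω Γ₁ T),
          HasFDerivAt (fun u₁ => e (u₁, μ, k, c)) D u ∧
          ∀ w v, D w v = -timeTerm w.dt v.1 + diffusionTerm k w.fn v.1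
            + convectionTerm c w.fn v.1 + boundaryTerm w.trace v.2) ∧
        (∃ D : RadonMeasure Ω →L[ℝ] StrongDual ℝ (TestSpace q Ω Γ₁ T),
          HasFDerivAt (fun μ₁ => e (u, μ₁, k, c)) D μ ∧
          ∀ η v, D η v = -sourceTerm η v.1) ∧
        (∃ D : LInfty Ω T ℝ →L[ℝ] StrongDual ℝ (TestSpace q Ω Γ₁ T),
          HasFDerivAt (fun k₁ => e (u, μ, k₁, c)) D k ∧
          ∀ h v, D h v = diffusionTerm h u.fn v.1) ∧
        (∃ D : LInfty Ω T (Sp d) →L[ℝ] StrongDual ℝ (TestSpace q Ω Γ₁ T),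
          HasFDerivAt (fun c₁ => e (u, μ, k, c₁)) D c ∧
          ∀ b v, D b v = convectionTerm b u.fn v.1) := by
  obtain ⟨hq, hq'⟩ := lt_and_ne_top_of_holderConjugate (q := q) hp hp'
  obtain ⟨S, hS⟩ := exists_sourceForm (T := T) hΩ.isOpen hq hq'
  let src : RadonMeasure Ω →L[ℝ] StrongDual ℝ (TestSpace q Ω Γ₁ T) :=
    -S.bilinearComp (.id ℝ _) (.fst ℝ _ _)
  have hsrc : ∀ η v, src η v = -sourceTerm η v.1 := fun η v => by
    rw [← hS]
    rfl
  let bdry : StrongDual ℝ (TestSpace q Ω Γ₁ T) := (boundaryForm Γ₁ T g).comp (.snd ℝ _ _)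
  have hbdry : ∀ v, bdry v = boundaryTerm g v.2 := fun v => boundaryForm_apply g v.2
  -- The boundary data are split off as the constant functional `bdry`, leaving an operator linear
  -- in the state plus one linear in the measure (`src` carries the minus sign).
  let e : StateSpace p q Ω Γ₁ T × ParamSpace Ω T → StrongDual ℝ (TestSpace q Ω Γ₁ T) :=
    fun x => stateOperator x.2.2.1 x.2.2.2 x.1 + src x.2.1 - bdry
  have he : ∀ u μ k c v, e (u, μ, k, c) v = weakForm g u μ k c v := by
    intro u μ k c v
    simp only [e, sub_apply, add_apply,
      stateOperator_apply, hsrc, hbdry, weakForm, boundaryTerm_sub]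
    ring
  refine ⟨e, he, fun u μ k c => ⟨⟨stateOperator k c, ?_, stateOperator_apply k c⟩,
    ⟨src, ?_, hsrc⟩, ⟨diffusionOperator u, ?_, diffusionOperator_apply u⟩,
    ⟨convectionOperator u, ?_, convectionOperator_apply u⟩⟩⟩ <;>
  refine hasFDerivAt_of_sub_eq _ (fun x y => ?_) _
  · simp only [e]
    abel
  · simp only [e]
    abel
  -- `stateOperator` is built as a linear map in the state only, so its dependence on a coefficient
  -- is seen after evaluating at `v`, where the terms without that coefficient cancel.
  · refine ContinuousLinearMap.ext fun v => ?_
    simp only [e, sub_apply, add_apply,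
      stateOperator_apply, diffusionOperator_apply]
    ring
  · refine ContinuousLinearMap.ext fun v => ?_
    simp only [e, sub_apply, add_apply,
      stateOperator_apply, convectionOperator_apply]
    ring
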